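/- **Setting.** Let $n,p\ge 1$, let $X$ be a random $n\times p$ feature matrix with rows $x_1^\top,\dots,x_n^\top$, and let $y=X\beta_0+\varepsilon$ with $\beta_0\in\mathbb R^p$, where the square-integrable errors satisfy $\mathbb E[\varepsilon\,|\,X]=0$ and $\mathbb E[\varepsilon\varepsilon^\top|\,X]=\sigma^2 I_n$ for some $\sigma>0$ (for instance, $(x_i,y_i)$ i.i.d. with $\mathbb E[\varepsilon_i|x_i]=0$ and $\operatorname{Var}(\varepsilon_i|x_i)=\sigma^2$). Let $\lambda\ge 0$, $\hat\Sigma=\frac1n X^\top X$, $\hat\Sigma_\lambda=\hat\Sigma+\lambda I_p$. For a real function $f$, $f(\hat\Sigma_\lambda)$ is defined by functional calculus, and the negative powers $\hat\Sigma_\lambda^{-1}$, $\hat\Sigma_\lambda^{-1/2}$ are those of the Moore–Penrose pseudoinverse if $\hat\Sigma_\lambda$ is singular. Let $s_1\ge\dots\ge s_p\ge0$ be the eigenvalues of $\hat\Sigma$ with orthonormal eigenvectors $v_1,\dots,v_p$, and $\tilde p$ the number of distinct nonzero eigenvalues. Assume that almost surely $\sum_{j:\,s_j=s_i}\langle X^\top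 y,v_j\rangle^2>0$ for all $i$ with $s_i>0$. Put $$y_\lambda=\tfrac1n\hat\Sigma_\lambda^{-1/2}X^\top y,\qquad \beta_\lambda=\hat\Sigma_\lambda^{-1}\hat\Sigma\beta_0 .$$ *Gradient flow:* $\hat\beta^{GF}_t=\hat\Sigma_\lambda^{-1/2}(I_p-\exp(-t\hat\Sigma_\lambda))y_\lambda$, $t\ge0$. *Conjugate gradients:* for $k=0,\dots,\tilde p$ let $R_k$ be the minimiser of $\|P(\hat\Sigma_\lambda)y_\lambda\|^2$ over polynomials $P$ of degree at most $k$ with $P(0)=1$. For $u=k+\alpha$ with $k\in\{0,\dots,\tilde p-1\}$, $\alpha\in(0,1]$, let $R_u=(1-\alpha)R_k+\alpha R_{k+1}$. For $u\in[0,\tilde p]$ let $\hat\beta^{CG}_u=\hat\Sigma_\lambda^{-1/2}(I_p-R_u(\hat\Sigma_\lambda))y_\lambda$. For $t\ge0$ let $$\tau_t=\inf\{u\in[0,\tilde p]:|R_u'(0)|\ge 2t\}\wedge\tilde p\qquad(\inf\emptyset=\infty).$$ *Risk:* for a target vector $\gamma\in\mathbb R^p$, $\mathcal R_{\lambda,\gamma}(\hat\beta)=\mathbb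 E\big[\|\hat\Sigma_\lambda^{1/2}(\hat\beta-\gamma)\|^2\,\big|\,X\big]$, computed under the regular conditional distribution of $y$ given $X$. *Spectral constant:* let $s_1+\lambda>0$ and $t\ge\frac1{2(s_1+\lambda)}$. If $2t(s_p+\lambda)<1$, let $i_t=\min\{j: s_j<(2t)^{-1}-\lambda\}\in\{2,\dots,p\}$ and, for $\mu\ge0$, $$C_t(\mu)=\Big(\sum_{j\ge i_t}s_j\Big)\Big(\sum_{j<i_t}\frac{(s_{i_t}+\mu)s_j}{s_j+\mu}+\sum_{j\ge i_t}\frac{(s_j+\mu)s_j}{s_{i_t-1}+\mu}\Big)^{-1}$$ (with $C_t(\mu)=0$ if $s_{i_t}=0$). If $2t(s_p+\lambda)\ge1$, let $C_t(\mu)=0$. Set $C_{t,\lambda}=C_t(\lambda)$ and $C_{t,0}=C_t(0)$. That is, $C_{t,0}$ has the same index $i_t$ (formed with $\lambda$) and the same case distinction as $C_{t,\lambda}$. **Theorem.** If $s_1+\lambda>0$ and $t\ge\frac1{2(s_1+\lambda)}=\frac1{2\|\hat\Sigma_\lambda\|}$, then $C_{t,\lambda}\le C_{t,0}$. Moreover,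 for almost every realisation of $X$ with $s_1+\lambda>0$, the following holds for all such $t$ and all $\gamma\in\mathbb R^p$ (which may depend on $X$) with $$\big\langle\hat\Sigma_\lambda\exp(-t\hat\Sigma_\lambda)\beta_\lambda,\;\gamma-\beta_\lambda\big\rangle\ge0:$$ $$\mathcal R_{\lambda,\gamma}\big(\hat\beta^{CG}_{\tau_t}\big)\le\frac{4(1+C_{t,\lambda})}{(1-e^{-1/2})^2}\,\mathcal R_{\lambda,\gamma}\big(\hat\beta^{GF}_t\big).$$ -/

import Mathlib

open MeasureTheory ProbabilityTheory
open scoped ENNReal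

noncomputable section

namespace RidgeCG

variable {n p : ℕ}

/-- The squared Euclidean norm of a vector. -/
def sqNorm {ι : Type*} [Fintype ι] (v : ι → ℝ) : ℝ := ∑ i, v i ^ 2

/-- The empirical covariance matrix `(1/n) Xᵀ X` of the feature matrix `X`. -/
def sigmaHat (X : Matrix (Fin n) (Fin p) ℝ) : Matrix (Fin p) (Fin p) ℝ :=
  (n : ℝ)⁻¹ • (X.transpose * X)

theorem sigmaHat_isHermitian (X : Matrix (Fin n) (Fin p) ℝ) : (sigmaHat X).IsHermitian := by
  unfold sigmaHat Matrix.IsHermitian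
  simp

/-- The functional calculus of the penalised empirical covariance matrix: with the diagonalisation
`Σ̂ = O diag(sⱼ) Oᵀ`, the matrix `Σ̂ + lam I` has the diagonalisation `O diag(sⱼ + lam) Oᵀ`,
and `fcalc X lam f` is the matrix `f(Σ̂ + lam I) = O diag(f(sⱼ + lam)) Oᵀ`. -/
def fcalc (X : Matrix (Fin n) (Fin p) ℝ) (lam : ℝ) (f : ℝ → ℝ) : Matrix (Fin p) (Fin p) ℝ :=
  (sigmaHat_isHermitian X).cfc (fun s => f (s + lam))

/-- The penalised empirical covariance matrix `Σ̂ + lam I`. -/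
def sigmaLam (X : Matrix (Fin n) (Fin p) ℝ) (lam : ℝ) : Matrix (Fin p) (Fin p) ℝ :=
  sigmaHat X + lam • (1 : Matrix (Fin p) (Fin p) ℝ)

/-- The square root of `Σ̂ + lam I`. -/
def sqrtSigma (X : Matrix (Fin n) (Fin p) ℝ) (lam : ℝ) : Matrix (Fin p) (Fin p) ℝ :=
  fcalc X lam Real.sqrt

/-- The inverse square root of `Σ̂ + lam I`. Since `0⁻¹ = 0` in `ℝ`, this is the square root of the
Moore-Penrose pseudoinverse when `Σ̂ + lam I` is singular (which can only occur for `lam = 0`). -/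
def invSqrtSigma (X : Matrix (Fin n) (Fin p) ℝ) (lam : ℝ) : Matrix (Fin p) (Fin p) ℝ :=
  fcalc X lam (fun x => (Real.sqrt x)⁻¹)

/-- The inverse (the Moore-Penrose pseudoinverse in the singular case) of `Σ̂ + lam I`. -/
def invSigma (X : Matrix (Fin n) (Fin p) ℝ) (lam : ℝ) : Matrix (Fin p) (Fin p) ℝ :=
  fcalc X lam (fun x => x⁻¹)

/-- The eigenvalues `s₁ ≥ ⋯ ≥ s_p ≥ 0` of `Σ̂`, with multiplicities, in decreasing order and
numbered from `1` to `p` (the value outside this index range is never used in a sum). -/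
def eig (X : Matrix (Fin n) (Fin p) ℝ) (j : ℕ) : ℝ :=
  if h : 1 ≤ j ∧ j ≤ p then
    (sigmaHat_isHermitian X).eigenvalues₀ ⟨j - 1, by rw [Fintype.card_fin]; omega⟩
  else 0

/-- The number of distinct nonzero eigenvalues of `Σ̂`, the index at which conjugate gradients
terminate. -/
def termIndex (X : Matrix (Fin n) (Fin p) ℝ) : ℕ :=
  ((Finset.univ.image (sigmaHat_isHermitian X).eigenvalues).filter (fun s => 0 < s)).card

/-- The nondegeneracy assumption on the data: the projection of `Xᵀ y` onto the eigenspace of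
every nonzero eigenvalue of `Σ̂` does not vanish, written as
`∑_{j : s_j = s_i} ⟨Xᵀ y, v_j⟩² > 0` for an orthonormal basis `(v_j)` of eigenvectors.
(The projection onto the kernel of `Σ̂` is always zero.) -/
def Nondegenerate (X : Matrix (Fin n) (Fin p) ℝ) (y : Fin n → ℝ) : Prop :=
  ∀ i : Fin p, 0 < (sigmaHat_isHermitian X).eigenvalues i →
    0 < ∑ j ∈ Finset.univ.filter (fun j : Fin p =>
          (sigmaHat_isHermitian X).eigenvalues j = (sigmaHat_isHermitian X).eigenvalues i),
        (X.transpose.mulVec y ⬝ᵥ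
          WithLp.ofLp ((sigmaHat_isHermitian X).eigenvectorBasis j)) ^ 2

/-- The transformed data `y_lam = (1/n) (Σ̂ + lam I)^{-1/2} Xᵀ y`. -/
def yLam (X : Matrix (Fin n) (Fin p) ℝ) (y : Fin n → ℝ) (lam : ℝ) : Fin p → ℝ :=
  (n : ℝ)⁻¹ • (invSqrtSigma X lam).mulVec (X.transpose.mulVec y)

/-- The vector `β_lam = (Σ̂ + lam I)⁻¹ Σ̂ β₀`. -/
def betaLam (X : Matrix (Fin n) (Fin p) ℝ) (β₀ : Fin p → ℝ) (lam : ℝ) : Fin p → ℝ :=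
  (invSigma X lam).mulVec ((sigmaHat X).mulVec β₀)

/-- The estimator `(Σ̂ + lam I)^{-1/2} (I - R(Σ̂ + lam I)) y_lam` with residual filter `R`. -/
def filterEst (X : Matrix (Fin n) (Fin p) ℝ) (y : Fin n → ℝ) (lam : ℝ) (R : ℝ → ℝ) : Fin p → ℝ :=
  (invSqrtSigma X lam).mulVec ((1 - fcalc X lam R).mulVec (yLam X y lam))

/-- The gradient flow estimator at time `t`, with residual filter `x ↦ exp(-t x)`. -/
def gradFlow (lam t : ℝ) (X : Matrix (Fin n) (Fin p) ℝ) (y : Fin n → ℝ) : Fin p → ℝ :=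
  filterEst X y lam (fun x => Real.exp (-t * x))

/-- `P` minimises `‖P(Σ̂ + lam I) y_lam‖²` among the polynomials of degree at most `k` with value
one at zero. -/
def IsResidualPoly (X : Matrix (Fin n) (Fin p) ℝ) (y : Fin n → ℝ) (lam : ℝ) (k : ℕ)
    (P : Polynomial ℝ) : Prop :=
  P.natDegree ≤ k ∧ P.eval 0 = 1 ∧
    ∀ Q : Polynomial ℝ, Q.natDegree ≤ k → Q.eval 0 = 1 →
      sqNorm ((fcalc X lam (fun x => P.eval x)).mulVec (yLam X y lam)) ≤
        sqNorm ((fcalc X lam (fun x => Q.eval x)).mulVec (yLam X y lam))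

open Classical in
/-- The residual polynomial of the `k`-th conjugate gradient iterate. The minimiser always exists;
on nondegenerate data it is unique for every `k ≤ termIndex X`, and has degree `k`. -/
def residualPoly (X : Matrix (Fin n) (Fin p) ℝ) (y : Fin n → ℝ) (lam : ℝ) (k : ℕ) :
    Polynomial ℝ :=
  if h : ∃ P, IsResidualPoly X y lam k P then h.choose else 1

/-- The residual polynomial interpolated linearly between consecutive integers: for `u = k + α`
with `k ∈ ℕ` and `α ∈ (0, 1]` it is `(1 - α) R_k + α R_{k+1}`; for `u = 0` it is `R_0`. -/
def residualInterp (X : Matrix (Fin n) (Fin p) ℝ) (y : Fin n → ℝ) (lam u : ℝ) : Polynomial ℝ :=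
  let k : ℕ := ⌈u⌉₊ - 1
  let α : ℝ := u - k
  Polynomial.C (1 - α) * residualPoly X y lam k + Polynomial.C α * residualPoly X y lam (k + 1)

/-- The interpolated conjugate gradient estimator at index `u ∈ [0, termIndex X]`. -/
def cgEst (lam u : ℝ) (X : Matrix (Fin n) (Fin p) ℝ) (y : Fin n → ℝ) : Fin p → ℝ :=
  filterEst X y lam (fun x => (residualInterp X y lam u).eval x)

/-- The data-dependent index `τ_t = inf {u ∈ [0, p̃] | |R_u'(0)| ≥ 2t} ∧ p̃`, where
`p̃ = termIndex X`; the infimum of the empty set counts as `+∞`. -/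
def tau (lam t : ℝ) (X : Matrix (Fin n) (Fin p) ℝ) (y : Fin n → ℝ) : ℝ :=
  sInf ({u : ℝ | 0 ≤ u ∧ u ≤ termIndex X ∧
      2 * t ≤ |(residualInterp X y lam u).derivative.eval 0|} ∪ {(termIndex X : ℝ)})

/-- The conjugate gradient estimator at the data-dependent index `τ_t`. -/
def cgAtTau (lam t : ℝ) (X : Matrix (Fin n) (Fin p) ℝ) (y : Fin n → ℝ) : Fin p → ℝ :=
  cgEst lam (tau lam t X y) X y

/-- The regularised in-sample prediction loss `‖(Σ̂ + lam I)^{1/2} (b - γ)‖²`. -/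
def loss (X : Matrix (Fin n) (Fin p) ℝ) (lam : ℝ) (γ b : Fin p → ℝ) : ℝ :=
  sqNorm ((sqrtSigma X lam).mulVec (b - γ))

/-- The regularised in-sample prediction risk `E[loss | X]` of an estimator `est`, a function of
the data `(X, y)`. It is the integral of the loss against the regular conditional distribution of
`y` given the feature vectors `x`, evaluated at the design `x ω`. As the loss is nonnegative, the
risk is taken in `[0, ∞]`. -/
def risk {Ω : Type*} [MeasurableSpace Ω] (P : Measure Ω) [IsProbabilityMeasure P]
    (x : Ω → Fin n → Fin p → ℝ) (y : Ω → Fin n → ℝ) (lam : ℝ) (γ : Fin p → ℝ)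
    (est : Matrix (Fin n) (Fin p) ℝ → (Fin n → ℝ) → Fin p → ℝ) (ω : Ω) : ℝ≥0∞ :=
  ∫⁻ z, ENNReal.ofReal (loss (Matrix.of (x ω)) lam γ (est (Matrix.of (x ω)) z))
    ∂(condDistrib y x P (x ω))

/-- The geometric condition on the target vector `γ` at the value `ρ`:
`⟨Σ_lam exp(-ρ Σ_lam / 2) β_lam, γ - β_lam⟩ ≥ 0`, where `Σ_lam = Σ̂ + lam I`. -/
def GammaCond (X : Matrix (Fin n) (Fin p) ℝ) (β₀ : Fin p → ℝ) (lam ρ : ℝ) (γ : Fin p → ℝ) : Prop :=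
  0 ≤ (sigmaLam X lam).mulVec
      ((fcalc X lam (fun x => Real.exp (-ρ * x / 2))).mulVec (betaLam X β₀ lam)) ⬝ᵥ
        (γ - betaLam X β₀ lam)

/-- The index `i_t = min {j ∈ {1, …, p} | s_j < (2t)⁻¹ - lam}`. -/
def specIndex (X : Matrix (Fin n) (Fin p) ℝ) (lam t : ℝ) : ℕ :=
  sInf {j : ℕ | 1 ≤ j ∧ j ≤ p ∧ eig X j < (2 * t)⁻¹ - lam}

/-- The spectral constant at time `t`: its index `i_t` and its case distinction
`t < (s_p + lam)⁻¹ / 2` (always true if `s_p + lam = 0`) are those of the penalty `lam`, and the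
penalty inside its sums is `mu`. The constant `C_{t,lam}` is `specConst X lam lam t`, and
`specConst X lam 0 t` is the same expression with the penalty in the sums replaced by zero. -/
def specConst (X : Matrix (Fin n) (Fin p) ℝ) (lam mu t : ℝ) : ℝ :=
  let i := specIndex X lam t
  if 2 * t * (eig X p + lam) < 1 then
    (∑ j ∈ Finset.Icc i p, eig X j) *
      (∑ j ∈ Finset.Ico 1 i, (eig X i + mu) * eig X j / (eig X j + mu) +
        ∑ j ∈ Finset.Icc i p, (eig X j + mu) * eig X j / (eig X (i - 1) + mu))⁻¹
  else 0

end RidgeCG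

end

/-!
In the eigenbasis of `Σ̂`, write `μ_j = s_j + lam` and let `η_j = m_j + ξ_j` be the coordinates of
the data `y_lam`: the signal `m_j` is the coordinate of `Σ_lam^{1/2} β_lam`, and the noise `ξ_j` is
centred with variance `v_j = σ² s_j / (n μ_j)` (`coord_yLam_eq_add`). With `g_j` the coordinates of
`Σ_lam^{1/2} γ`, an estimator with residual filter `R` has loss `∑ ((1 - R(μ_j)) η_j - g_j)²`.

For gradient flow the cross term between `e^{-t μ_j} m_j` and `g_j - m_j` is nonnegative by the
condition on `γ`, so the risk is at least
`∑ (m_j - g_j)² + ∑ e^{-2 t μ_j} m_j² + ∑ (1 - e^{-t μ_j})² v_j`.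

For conjugate gradients, optimality makes the residual polynomial `R_k` orthogonal, for the weights
`μ_j η_j²`, to all polynomials of lower degree. Hence the interpolated residual polynomial `R` has
only positive real roots (`exists_interp_eq_rootProd`), and if `x₁` is the smallest of them, `R` is
nonnegatively correlated with `R / (1 - X / x₁)` (`interp_mul_cofactor_nonneg`). The correlation
gives `∑_{μ_j ≥ x₁} R² η² ≤ ∑_{μ_j < x₁} R (1 - R) η²`, and together with the identity
`((1 - R) ξ - R m)² + R (1 - R) (m + ξ)² = (1 - R) ξ² + R m²` it bounds the error
`∑ (ξ_j - R(μ_j) η_j)²` by twice the sum of `R m² + (1 - R) ξ²` over `μ_j < x₁` and of `ξ²` over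
`μ_j ≥ x₁` (`sum_sq_noise_sub_residual_le`). Before `x₁` the real-rooted `R` is at most
`exp (-|R'(0)| x)` and at least `1 - |R'(0)| x`. At `τ_t` the slope `|R'(0)|` is exactly `2 t`, by
continuity in the interpolation index, unless the iteration terminates before; in that case the
residual vanishes and all nonzero eigenvalues satisfy `2 t μ_j ≥ 1`. Either way the risk is at most
`2 ∑ (m_j - g_j)² + 4 ∑ e^{-2 t μ_j} m_j² + 4 ∑ min (1, 2 t μ_j) v_j`.

The variance terms are compared through `(1 - e^{-1/2}) min (1, 2 t x) ≤ 1 - e^{-t x}` and the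
spectral constant, which is what is needed for passing from `min (1, 2 t μ_j)` to its square
(`sum_min_le_specConst_mul`).
-/

open MeasureTheory ProbabilityTheory
open scoped ENNReal

namespace RidgeCG

open Polynomial

/-! ### Polynomials with positive roots -/

/-- The polynomial `∏ (1 - X / a)` over the multiset `S` (normalised to have value one at zero). -/
noncomputable def rootProd (S : Multiset ℝ) : ℝ[X] := (S.map fun a => 1 - C a⁻¹ * X).prod

@[simp] theorem rootProd_zero : rootProd 0 = 1 := by simp [rootProd]

@[simp] theorem rootProd_cons (a : ℝ) (S : Multiset ℝ) :
    rootProd (a ::ₘ S) = (1 - C a⁻¹ * X) * rootProd S := by simp [rootProd]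

@[simp] theorem rootProd_eval_zero (S : Multiset ℝ) : (rootProd S).eval 0 = 1 := by
  induction S using Multiset.induction_on with
  | empty => simp
  | cons a S ih => simp [ih]

theorem rootProd_derivative_eval_zero (S : Multiset ℝ) :
    (rootProd S).derivative.eval 0 = -(S.map fun a => a⁻¹).sum := by
  induction S using Multiset.induction_on with
  | empty => simp
  | cons a S ih => simp [ih]; ring

theorem natDegree_one_sub_C_mul_X {a : ℝ} (ha : a ≠ 0) :
    (1 - C a⁻¹ * X : ℝ[X]).natDegree = 1 ∧ (1 - C a⁻¹ * X : ℝ[X]).leadingCoeff = -a⁻¹ := by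
  have h : (1 - C a⁻¹ * X : ℝ[X]) = C (-a⁻¹) * X + C 1 := by simp; ring
  have ha' : -a⁻¹ ≠ 0 := by simpa using ha
  rw [h]
  exact ⟨natDegree_linear ha', leadingCoeff_linear ha'⟩

theorem rootProd_natDegree_and_sign {S : Multiset ℝ} (hS : ∀ a ∈ S, 0 < a) :
    (rootProd S).natDegree = S.card ∧ 0 < (-1) ^ S.card * (rootProd S).leadingCoeff := by
  induction S using Multiset.induction_on with
  | empty => simp
  | cons a S ih =>
    obtain ⟨h1, h2⟩ := ih fun b hb => hS b (Multiset.mem_cons_of_mem hb)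
    have ha : 0 < a := hS a (Multiset.mem_cons_self a S)
    obtain ⟨h3, h4⟩ := natDegree_one_sub_C_mul_X ha.ne'
    have hne : rootProd S ≠ 0 := by
      intro h
      simp [h] at h2
    have hne' : (1 - C a⁻¹ * X : ℝ[X]) ≠ 0 := by
      intro h
      simp [h] at h3
    refine ⟨?_, ?_⟩
    · rw [rootProd_cons, natDegree_mul hne' hne, h1, h3, Multiset.card_cons, add_comm]
    · rw [rootProd_cons, leadingCoeff_mul, h4, Multiset.card_cons, pow_succ]
      have : 0 < a⁻¹ := inv_pos.2 ha
      calc 0 < a⁻¹ * ((-1) ^ S.card * (rootProd S).leadingCoeff) := mul_pos this h2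
        _ = _ := by ring

/-- Up to its smallest root, `rootProd S` lies between `0` and `1`, below the exponential with the
same slope at zero, and above its tangent at zero. -/
theorem rootProd_bounds {S : Multiset ℝ} {x : ℝ} (hx : 0 ≤ x) (hS : ∀ a ∈ S, 0 < a)
    (hxS : ∀ a ∈ S, x ≤ a) :
    0 ≤ (rootProd S).eval x ∧ (rootProd S).eval x ≤ 1 ∧
      (rootProd S).eval x ≤ Real.exp (-((S.map fun a => a⁻¹).sum * x)) ∧
      1 - (rootProd S).eval x ≤ (S.map fun a => a⁻¹).sum * x := by
  induction S using Multiset.induction_on with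
  | empty => simp
  | cons a S ih =>
    obtain ⟨h1, h2, h3, h4⟩ := ih (fun b hb => hS b (Multiset.mem_cons_of_mem hb))
      (fun b hb => hxS b (Multiset.mem_cons_of_mem hb))
    have ha : 0 < a := hS a (Multiset.mem_cons_self a S)
    have hxa : x ≤ a := hxS a (Multiset.mem_cons_self a S)
    have e0 : 0 ≤ a⁻¹ * x := by positivity
    have e1 : a⁻¹ * x ≤ 1 := by rw [inv_mul_le_iff₀ ha]; simpa using hxa
    simp only [rootProd_cons, eval_mul, eval_sub, eval_one, eval_C, eval_X, Multiset.map_cons,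
      Multiset.sum_cons]
    set q := (rootProd S).eval x
    set θ := (S.map fun a => a⁻¹).sum
    refine ⟨mul_nonneg (by linarith) h1, ?_, ?_, ?_⟩
    · nlinarith
    · calc (1 - a⁻¹ * x) * q ≤ Real.exp (-(a⁻¹ * x)) * Real.exp (-(θ * x)) := by
            gcongr
            linarith [Real.add_one_le_exp (-(a⁻¹ * x))]
        _ = _ := by rw [← Real.exp_add]; congr 1; ring
    · nlinarith

theorem dvd_rootProd_of_root {R : ℝ[X]} {a : ℝ} (ha : a ≠ 0) (h : R.eval a = 0) :
    (1 - C a⁻¹ * X : ℝ[X]) ∣ R := by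
  have h1 : (X - C a : ℝ[X]) ∣ R := dvd_iff_isRoot.2 h
  have h2 : (X - C a : ℝ[X]) = C (-a) * (1 - C a⁻¹ * X) := by
    rw [mul_sub, ← mul_assoc, ← C_mul]
    simp [ha]
    ring
  rw [h2] at h1
  exact dvd_of_mul_left_dvd h1

/-- The sign changes of a real polynomial on the positive half-line can be cancelled by a factor of
it: dividing out one positive root after the other, as long as there is a negative value, leaves a
cofactor that is nonnegative there. -/
theorem exists_rootProd_dvd_mul_nonneg (R : ℝ[X]) (h0 : 0 < R.eval 0) :
    ∃ S : Multiset ℝ, (∀ a ∈ S, 0 < a) ∧ rootProd S ∣ R ∧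
      ∀ x, 0 ≤ x → 0 ≤ R.eval x * (rootProd S).eval x := by
  induction hd : R.natDegree using Nat.strong_induction_on generalizing R with
  | _ d ih =>
    by_cases hpos : ∀ x, 0 ≤ x → 0 ≤ R.eval x
    · exact ⟨0, by simp, by simp, by simpa using hpos⟩
    push Not at hpos
    obtain ⟨x, hx, hRx⟩ := hpos
    obtain ⟨a, ⟨ha0, -⟩, ha⟩ : (0 : ℝ) ∈ (fun y => R.eval y) '' Set.Icc 0 x :=
      intermediate_value_Icc' hx R.continuous.continuousOn ⟨hRx.le, h0.le⟩
    have hapos : 0 < a := by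
      rcases ha0.lt_or_eq with h | h
      · exact h
      · subst h
        simp only at ha
        linarith
    obtain ⟨T, rfl⟩ := dvd_rootProd_of_root hapos.ne' ha
    have hT0 : 0 < T.eval 0 := by simpa using h0
    have hTne : T ≠ 0 := by
      rintro rfl
      simp at hT0
    have hne' : (1 - C a⁻¹ * X : ℝ[X]) ≠ 0 := by
      intro h
      simp [h] at h0
    have hdeg : T.natDegree < d := by
      rw [← hd, natDegree_mul hne' hTne, (natDegree_one_sub_C_mul_X hapos.ne').1]
      omega
    obtain ⟨S, hS, hdvd, hnn⟩ := ih _ hdeg T hT0 rfl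
    refine ⟨a ::ₘ S, ?_, ?_, ?_⟩
    · intro b hb
      rcases Multiset.mem_cons.1 hb with rfl | hb
      · exact hapos
      · exact hS b hb
    · rw [rootProd_cons]
      exact mul_dvd_mul_left _ hdvd
    · intro y hy
      simp only [rootProd_cons, eval_mul]
      calc 0 ≤ (eval y (1 - C a⁻¹ * X)) ^ 2 * (T.eval y * (rootProd S).eval y) :=
            mul_nonneg (sq_nonneg _) (hnn y hy)
        _ = _ := by ring

theorem rootProd_dvd_of_forall_root {R : ℝ[X]} (F : Finset ℝ) (hF : ∀ a ∈ F, 0 < a)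
    (h : ∀ a ∈ F, R.eval a = 0) : rootProd F.val ∣ R := by
  induction F using Finset.induction_on generalizing R with
  | empty => simp
  | insert a F haF ih =>
    have ha : a ≠ 0 := (hF a (Finset.mem_insert_self a F)).ne'
    obtain ⟨T, rfl⟩ := dvd_rootProd_of_root ha (h a (Finset.mem_insert_self a F))
    rw [Finset.insert_val_of_notMem haF, rootProd_cons]
    refine mul_dvd_mul_left _ (ih (fun b hb => hF b (Finset.mem_insert_of_mem hb)) ?_)
    intro b hb
    have hb' := h b (Finset.mem_insert_of_mem hb)
    rw [eval_mul] at hb'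
    refine (mul_eq_zero.1 hb').resolve_left fun h0 => haF ?_
    have : b = a := by
      simp only [eval_sub, eval_one, eval_mul, eval_C, eval_X] at h0
      field_simp at h0
      linarith
    exact this ▸ hb

theorem eval_eq_zero_of_mem {S : Multiset ℝ} {a : ℝ} (ha : a ∈ S) (h0 : a ≠ 0) :
    (rootProd S).eval a = 0 := by
  obtain ⟨T, rfl⟩ := Multiset.exists_cons_of_mem ha
  simp [h0]

theorem mem_of_eval_eq_zero {S : Multiset ℝ} (hS : ∀ a ∈ S, 0 < a) {x : ℝ}
    (h : (rootProd S).eval x = 0) : x ∈ S := by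
  induction S using Multiset.induction_on with
  | empty => simp at h
  | cons a S ih =>
    rw [rootProd_cons, eval_mul] at h
    rcases mul_eq_zero.1 h with h | h
    · have ha : 0 < a := hS a (Multiset.mem_cons_self a S)
      simp only [eval_sub, eval_one, eval_mul, eval_C, eval_X] at h
      field_simp at h
      rw [Multiset.mem_cons]
      left
      linarith
    · exact Multiset.mem_cons_of_mem (ih (fun b hb => hS b (Multiset.mem_cons_of_mem hb)) h)

/-! ### Residual polynomials of conjugate gradients in eigen-coordinates -/

/-- The points `μ j` that carry a nonzero coefficient `η j`. -/
noncomputable def activePoints {ι : Type*} [Fintype ι] (μ η : ι → ℝ) : Finset ℝ := by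
  classical exact (Finset.univ.filter fun j => η j ≠ 0).image μ

theorem mem_activePoints {ι : Type*} [Fintype ι] {μ η : ι → ℝ} {x : ℝ} :
    x ∈ activePoints μ η ↔ ∃ j, η j ≠ 0 ∧ μ j = x := by
  classical
  simp [activePoints]

/-- `P` minimises `∑ (P(μ j) η j)²` among the polynomials of degree at most `k` with value one at
zero: the conjugate gradient residual polynomial in eigen-coordinates. -/
def IsMinimalResidual {ι : Type*} [Fintype ι] (μ η : ι → ℝ) (k : ℕ) (P : ℝ[X]) : Prop :=
  P.natDegree ≤ k ∧ P.eval 0 = 1 ∧ ∀ Q : ℝ[X], Q.natDegree ≤ k → Q.eval 0 = 1 →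
    ∑ j, (P.eval (μ j) * η j) ^ 2 ≤ ∑ j, (Q.eval (μ j) * η j) ^ 2

theorem eq_zero_of_forall_quadratic_nonneg {A B : ℝ} (h : ∀ e : ℝ, 0 ≤ 2 * e * B + e ^ 2 * A) :
    B = 0 := by
  have hA := h (-B / (|A| + 1))
  have hpos : 0 < |A| + 1 := by positivity
  have h1 : 2 * (-B / (|A| + 1)) * B + (-B / (|A| + 1)) ^ 2 * A =
      (B ^ 2 / (|A| + 1) ^ 2) * (A - 2 * (|A| + 1)) := by
    field_simp
    ring
  rw [h1] at hA
  by_contra hB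
  have h2 : 0 < B ^ 2 / (|A| + 1) ^ 2 := by positivity
  have h3 : A - 2 * (|A| + 1) < 0 := by linarith [le_abs_self A, abs_nonneg A]
  linarith [mul_neg_of_pos_of_neg h2 h3]

section CG

variable {ι : Type*} [Fintype ι] {μ η : ι → ℝ}

/-- First-order optimality: a minimal residual polynomial is orthogonal to all polynomials of lower
degree for the weights `μ j * η j ^ 2`. -/
theorem IsMinimalResidual.orthogonal {k : ℕ} {P : ℝ[X]} (h : IsMinimalResidual μ η k P) (Q : ℝ[X])
    (hQ : Q.degree < k) : ∑ j, P.eval (μ j) * Q.eval (μ j) * (μ j * η j ^ 2) = 0 := by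
  obtain ⟨hdeg, h0, hmin⟩ := h
  refine eq_zero_of_forall_quadratic_nonneg (A := ∑ j, (μ j * Q.eval (μ j) * η j) ^ 2) fun e => ?_
  have hXQ : (X * Q).natDegree ≤ k := by
    rcases eq_or_ne Q 0 with rfl | hQ0
    · simp
    · rw [natDegree_X_mul hQ0]
      exact (natDegree_lt_iff_degree_lt hQ0).2 hQ
  have := hmin (P + C e * (X * Q))
    (natDegree_add_le_of_degree_le hdeg ((natDegree_C_mul_le _ _).trans hXQ)) (by simp [h0])
  rw [← sub_nonneg, ← Finset.sum_sub_distrib] at this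
  rw [Finset.mul_sum, Finset.mul_sum, ← Finset.sum_add_distrib]
  refine this.trans (Finset.sum_le_sum fun j _ => le_of_eq ?_)
  simp only [eval_add, eval_mul, eval_C, eval_X]
  ring

/-- A polynomial that is orthogonal to all polynomials of degree less than `m`, for a positive
weight on at least `m` positive points, has at least `m` positive roots, counted with multiplicity. -/
theorem exists_rootProd_dvd_of_orthogonal (hμ : ∀ j, η j ≠ 0 → 0 < μ j) {R : ℝ[X]}
    (h0 : R.eval 0 = 1) {m : ℕ} (hm : m ≤ (activePoints μ η).card)
    (horth : ∀ Q : ℝ[X], Q.degree < m →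
      ∑ j, R.eval (μ j) * Q.eval (μ j) * (μ j * η j ^ 2) = 0) :
    ∃ S : Multiset ℝ, (∀ a ∈ S, 0 < a) ∧ m ≤ S.card ∧ rootProd S ∣ R := by
  obtain ⟨S, hS, hdvd, hnn⟩ := exists_rootProd_dvd_mul_nonneg R (by rw [h0]; exact one_pos)
  by_cases hcard : m ≤ S.card
  · exact ⟨S, hS, hcard, hdvd⟩
  have hlt : (rootProd S).degree < m := by
    refine degree_le_natDegree.trans_lt ?_
    rw [(rootProd_natDegree_and_sign hS).1]
    exact_mod_cast not_le.1 hcard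
  have hsum := horth _ hlt
  have hterm : ∀ j ∈ Finset.univ,
      0 ≤ R.eval (μ j) * (rootProd S).eval (μ j) * (μ j * η j ^ 2) := by
    intro j _
    by_cases hj : η j = 0
    · simp [hj]
    · have := hμ j hj
      exact mul_nonneg (hnn _ this.le) (by positivity)
  have hzero := (Finset.sum_eq_zero_iff_of_nonneg hterm).1 hsum
  have hroot : ∀ a ∈ activePoints μ η, R.eval a = 0 := by
    intro a ha
    obtain ⟨j, hj, rfl⟩ := mem_activePoints.1 ha
    have h1 := hzero j (Finset.mem_univ j)
    have h2 : μ j * η j ^ 2 ≠ 0 := mul_ne_zero (hμ j hj).ne' (pow_ne_zero 2 hj)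
    rcases mul_eq_zero.1 ((mul_eq_zero.1 h1).resolve_right h2) with h3 | h3
    · exact h3
    · exact eval_eq_zero_of_dvd_of_eval_eq_zero hdvd h3
  have hpos : ∀ a ∈ activePoints μ η, 0 < a := by
    intro a ha
    obtain ⟨j, hj, rfl⟩ := mem_activePoints.1 ha
    exact hμ j hj
  exact ⟨(activePoints μ η).val, fun a ha => hpos a ha, hm,
    rootProd_dvd_of_forall_root _ hpos hroot⟩

theorem IsMinimalResidual.exists_eq_rootProd (hμ : ∀ j, η j ≠ 0 → 0 < μ j) {k : ℕ} {P : ℝ[X]}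
    (h : IsMinimalResidual μ η k P) (hk : k ≤ (activePoints μ η).card) :
    ∃ S : Multiset ℝ, (∀ a ∈ S, 0 < a) ∧ S.card = k ∧ P = rootProd S := by
  obtain ⟨S, hS, hcard, T, rfl⟩ := exists_rootProd_dvd_of_orthogonal hμ h.2.1 hk h.orthogonal
  have hT0 : T.eval 0 = 1 := by simpa using h.2.1
  have hTne : T ≠ 0 := by
    rintro rfl
    simp at hT0
  obtain ⟨h1, h2⟩ := rootProd_natDegree_and_sign hS
  have hne : rootProd S ≠ 0 := by
    intro h
    simp [h] at h2
  have hdeg := h.1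
  rw [natDegree_mul hne hTne, h1] at hdeg
  have hT : T = 1 := by
    rw [← coeff_zero_eq_eval_zero] at hT0
    rw [eq_C_of_natDegree_eq_zero (show T.natDegree = 0 by omega), hT0, C_1]
  exact ⟨S, hS, by omega, by simp [hT]⟩

/-- The linear interpolation of two consecutive residual polynomials has only positive real roots:
orthogonality leaves room for a single further linear factor, and comparing leading coefficients
shows that its root is positive. -/
theorem exists_interp_eq_rootProd (hμ : ∀ j, η j ≠ 0 → 0 < μ j) {k : ℕ} {P P' : ℝ[X]}
    (h : IsMinimalResidual μ η k P) (h' : IsMinimalResidual μ η (k + 1) P')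
    (hk : k + 1 ≤ (activePoints μ η).card) {α : ℝ} (hα : 0 < α) :
    ∃ S : Multiset ℝ, (∀ a ∈ S, 0 < a) ∧ S.card = k + 1 ∧
      C (1 - α) * P + C α * P' = rootProd S := by
  obtain ⟨U, hU, hUcard, rfl⟩ := h'.exists_eq_rootProd hμ hk
  set R := C (1 - α) * P + C α * rootProd U with hR
  have hR0 : R.eval 0 = 1 := by simp [hR, h.2.1]
  have horth : ∀ Q : ℝ[X], Q.degree < k →
      ∑ j, R.eval (μ j) * Q.eval (μ j) * (μ j * η j ^ 2) = 0 := by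
    intro Q hQ
    have e1 := h.orthogonal Q hQ
    have e2 := h'.orthogonal Q (hQ.trans (by exact_mod_cast k.lt_succ_self))
    calc _ = (1 - α) * ∑ j, P.eval (μ j) * Q.eval (μ j) * (μ j * η j ^ 2) +
          α * ∑ j, (rootProd U).eval (μ j) * Q.eval (μ j) * (μ j * η j ^ 2) := by
            rw [Finset.mul_sum, Finset.mul_sum, ← Finset.sum_add_distrib]
            refine Finset.sum_congr rfl fun j _ => ?_
            simp only [hR, eval_add, eval_mul, eval_C]
            ring
      _ = 0 := by rw [e1, e2]; ring
  obtain ⟨S, hS, hcard, T, hT⟩ := exists_rootProd_dvd_of_orthogonal hμ hR0 (by omega) horth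
  obtain ⟨hU1, hU2⟩ := rootProd_natDegree_and_sign hU
  obtain ⟨hS1, hS2⟩ := rootProd_natDegree_and_sign hS
  have hPcoeff : P.coeff (k + 1) = 0 := coeff_eq_zero_of_natDegree_lt (by have := h.1; omega)
  have hRcoeff : R.coeff (k + 1) = α * (rootProd U).leadingCoeff := by
    rw [hR, coeff_add, coeff_C_mul, coeff_C_mul, hPcoeff, leadingCoeff, hU1, hUcard]
    ring
  have hsign : 0 < (-1) ^ (k + 1) * R.coeff (k + 1) := by
    rw [hRcoeff, ← hUcard]
    calc 0 < α * ((-1) ^ U.card * (rootProd U).leadingCoeff) := mul_pos hα hU2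
      _ = _ := by ring
  have hRle : R.natDegree ≤ k + 1 :=
    natDegree_add_le_of_degree_le ((natDegree_C_mul_le _ _).trans (by have := h.1; omega))
      ((natDegree_C_mul_le _ _).trans (by omega))
  have hRdeg : R.natDegree = k + 1 :=
    natDegree_eq_of_le_of_coeff_ne_zero hRle (by intro h0; simp [h0] at hsign)
  have hT0 : T.eval 0 = 1 := by
    rw [hT] at hR0
    simpa using hR0
  have hTne : T ≠ 0 := by
    rintro rfl
    simp at hT0
  have hne : rootProd S ≠ 0 := by
    intro h
    simp [h] at hS2
  have hdeg : S.card + T.natDegree = k + 1 := by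
    rw [← hRdeg, hT, natDegree_mul hne hTne, hS1]
  have hlead : R.coeff (k + 1) = (rootProd S).leadingCoeff * T.leadingCoeff := by
    rw [← hRdeg, coeff_natDegree, hT, leadingCoeff_mul]
  rcases (show T.natDegree = 0 ∨ T.natDegree = 1 by omega) with hT1 | hT1
  · have hT2 : T = 1 := by
      rw [← coeff_zero_eq_eval_zero] at hT0
      rw [eq_C_of_natDegree_eq_zero hT1, hT0, C_1]
    exact ⟨S, hS, by omega, by rw [hT, hT2, mul_one]⟩
  · have hScard : S.card = k := by omega
    set b := T.leadingCoeff with hb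
    have hTeq : T = C b * X + C 1 := by
      have h3 := eq_X_add_C_of_natDegree_le_one hT1.le
      have h4 : T.coeff 0 = 1 := by rw [coeff_zero_eq_eval_zero, hT0]
      have h5 : T.coeff 1 = b := by rw [hb, leadingCoeff, hT1]
      rwa [h4, h5] at h3
    have hbneg : b < 0 := by
      rw [hlead, pow_succ] at hsign
      rw [hScard] at hS2
      have : 0 < ((-1) ^ k * (rootProd S).leadingCoeff) * (-b) := by
        calc 0 < _ := hsign
          _ = _ := by ring
      have := pos_of_mul_pos_right this hS2.le
      linarith
    refine ⟨(-b)⁻¹ ::ₘ S, ?_, by simp [hScard], ?_⟩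
    · intro a ha
      rcases Multiset.mem_cons.1 ha with rfl | ha
      · exact inv_pos.2 (by linarith)
      · exact hS a ha
    · rw [hT, rootProd_cons, hTeq, inv_inv, mul_comm]
      congr 1
      simp
      ring

/-- The interpolated residual is nonnegatively correlated with every polynomial of degree `k` whose
roots are positive, because such a polynomial and the `k`-th residual polynomial have leading
coefficients of the same sign. This is applied to the quotient of the interpolated residual by one
of its `k + 1` linear factors. -/
theorem interp_mul_cofactor_nonneg (hμ : ∀ j, η j ≠ 0 → 0 < μ j) {k : ℕ} {P P' : ℝ[X]}
    (h : IsMinimalResidual μ η k P) (h' : IsMinimalResidual μ η (k + 1) P')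
    (hk : k ≤ (activePoints μ η).card) {α : ℝ} (hα : α ≤ 1)
    {S : Multiset ℝ} (hS : ∀ a ∈ S, 0 < a) (hcard : S.card = k) :
    0 ≤ ∑ j, (C (1 - α) * P + C α * P').eval (μ j) * (rootProd S).eval (μ j) *
      (μ j * η j ^ 2) := by
  obtain ⟨U, hU, hUcard, hP⟩ := h.exists_eq_rootProd hμ hk
  obtain ⟨hU1, hU2⟩ := rootProd_natDegree_and_sign hU
  obtain ⟨hS1, hS2⟩ := rootProd_natDegree_and_sign hS
  rw [← hP] at hU1 hU2
  have hPne : P.leadingCoeff ≠ 0 := by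
    intro h0
    simp [h0] at hU2
  set c := (rootProd S).leadingCoeff / P.leadingCoeff with hc
  have hcnn : 0 ≤ c := by
    have : c = ((-1) ^ S.card * (rootProd S).leadingCoeff) /
        ((-1) ^ U.card * P.leadingCoeff) := by
      rw [hcard, hUcard, mul_div_mul_left _ _ (pow_ne_zero k (by norm_num))]
    rw [this]
    positivity
  have hlow : (rootProd S - C c * P).degree < k := by
    rw [degree_lt_iff_coeff_zero]
    intro i hi
    rcases hi.eq_or_lt with rfl | hi
    · have e1 : (rootProd S).coeff k = (rootProd S).leadingCoeff := by
        rw [leadingCoeff, hS1, hcard]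
      have e2 : P.coeff k = P.leadingCoeff := by rw [leadingCoeff, hU1, hUcard]
      rw [coeff_sub, coeff_C_mul, e1, e2, hc]
      field_simp
      ring
    · rw [coeff_sub, coeff_C_mul, coeff_eq_zero_of_natDegree_lt (by omega),
        coeff_eq_zero_of_natDegree_lt (p := P) (by omega)]
      ring
  have e1 := h.orthogonal _ hlow
  have e2 := h'.orthogonal (rootProd S) (by
    refine degree_le_natDegree.trans_lt ?_
    rw [hS1, hcard]
    exact_mod_cast k.lt_succ_self)
  have e3 : ∑ j, P.eval (μ j) * (rootProd S).eval (μ j) * (μ j * η j ^ 2) =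
      c * ∑ j, P.eval (μ j) ^ 2 * (μ j * η j ^ 2) := by
    rw [Finset.mul_sum, ← sub_eq_zero, ← Finset.sum_sub_distrib, ← e1]
    refine Finset.sum_congr rfl fun j _ => ?_
    simp only [eval_sub, eval_mul, eval_C]
    ring
  have e4 : 0 ≤ ∑ j, P.eval (μ j) ^ 2 * (μ j * η j ^ 2) := by
    refine Finset.sum_nonneg fun j _ => ?_
    by_cases hj : η j = 0
    · simp [hj]
    · have := hμ j hj
      positivity
  calc 0 ≤ (1 - α) * (c * ∑ j, P.eval (μ j) ^ 2 * (μ j * η j ^ 2)) :=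
        mul_nonneg (by linarith) (mul_nonneg hcnn e4)
    _ = (1 - α) * ∑ j, P.eval (μ j) * (rootProd S).eval (μ j) * (μ j * η j ^ 2) +
        α * ∑ j, P'.eval (μ j) * (rootProd S).eval (μ j) * (μ j * η j ^ 2) := by
          rw [e2, e3]; ring
    _ = _ := by
          rw [Finset.mul_sum, Finset.mul_sum, ← Finset.sum_add_distrib]
          refine Finset.sum_congr rfl fun j _ => ?_
          simp only [eval_add, eval_mul, eval_C]
          ring

/-- From the termination index on, a minimal residual polynomial annihilates the data. -/
theorem IsMinimalResidual.eval_mul_eq_zero (hμ : ∀ j, η j ≠ 0 → 0 < μ j) {k : ℕ} {P : ℝ[X]}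
    (h : IsMinimalResidual μ η k P) (hk : (activePoints μ η).card ≤ k) (j : ι) :
    P.eval (μ j) * η j = 0 := by
  have hpos : ∀ a ∈ (activePoints μ η).val, 0 < a := by
    intro a ha
    obtain ⟨j, hj, rfl⟩ := mem_activePoints.1 (show a ∈ activePoints μ η from ha)
    exact hμ j hj
  have h1 := h.2.2 (rootProd (activePoints μ η).val)
    (by rw [(rootProd_natDegree_and_sign hpos).1]; exact hk) (by simp)
  have h2 : ∑ i, ((rootProd (activePoints μ η).val).eval (μ i) * η i) ^ 2 = 0 := by
    refine Finset.sum_eq_zero fun i _ => ?_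
    by_cases hi : η i = 0
    · simp [hi]
    · have hmem : μ i ∈ (activePoints μ η).val := mem_activePoints.2 ⟨i, hi, rfl⟩
      simp [eval_eq_zero_of_mem hmem (hμ i hi).ne']
  rw [h2] at h1
  have h3 := (Finset.sum_eq_zero_iff_of_nonneg fun i _ => sq_nonneg _).1
    (h1.antisymm (Finset.sum_nonneg fun i _ => sq_nonneg (P.eval (μ i) * η i)))
  exact pow_eq_zero_iff two_ne_zero |>.1 (h3 j (Finset.mem_univ j))

/-- Minimal residual polynomials exist: the origin has a nearest point in the finite-dimensional
affine space of all vectors `(P(μ j) η j)ⱼ`. -/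
theorem exists_isMinimalResidual (μ η : ι → ℝ) (k : ℕ) : ∃ P, IsMinimalResidual μ η k P := by
  let L : ℝ[X] →ₗ[ℝ] EuclideanSpace ℝ ι :=
    { toFun := fun Q => WithLp.toLp 2 fun j => μ j * Q.eval (μ j) * η j
      map_add' := fun Q Q' => by ext j; simp; ring
      map_smul' := fun c Q => by ext j; simp; ring }
  let K : Submodule ℝ (EuclideanSpace ℝ ι) := (degreeLT ℝ k).map L
  let a : EuclideanSpace ℝ ι := WithLp.toLp 2 η
  obtain ⟨v, hv, hvmin⟩ := K.exists_norm_eq_iInf_of_complete_subspace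
    (Submodule.complete_of_finiteDimensional K) a
  obtain ⟨Q, hQ, rfl⟩ := hv
  have hnorm : ∀ T : ℝ[X], ‖a - L T‖ ^ 2 = ∑ j, ((1 - X * T).eval (μ j) * η j) ^ 2 := by
    intro T
    rw [EuclideanSpace.norm_sq_eq]
    refine Finset.sum_congr rfl fun j _ => ?_
    simp only [a, L, LinearMap.coe_mk, AddHom.coe_mk, PiLp.sub_apply, Real.norm_eq_abs, sq_abs,
      eval_sub, eval_one, eval_mul, eval_X]
    ring
  have hdeg : (1 - X * Q).natDegree ≤ k := by
    rcases eq_or_ne Q 0 with rfl | hQ0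
    · simp
    · have h1 : Q.natDegree < k := (natDegree_lt_iff_degree_lt hQ0).2 (mem_degreeLT.1 hQ)
      refine (natDegree_sub_le _ _).trans ?_
      rw [natDegree_X_mul hQ0]
      simp
      omega
  refine ⟨1 - X * Q, hdeg, by simp, fun T hT hT0 => ?_⟩
  obtain ⟨V, hV⟩ : X ∣ 1 - T := by
    rw [X_dvd_iff, coeff_zero_eq_eval_zero]
    simp [hT0]
  have hVk : V ∈ degreeLT ℝ k := by
    rw [mem_degreeLT]
    rcases eq_or_ne V 0 with rfl | hV0
    · simp
    · rw [← natDegree_lt_iff_degree_lt hV0]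
      have h1 : (X * V).natDegree ≤ k := by
        rw [← hV]
        exact (natDegree_sub_le _ _).trans (by simpa using hT)
      rw [natDegree_X_mul hV0] at h1
      omega
  have hTV : T = 1 - X * V := by rw [← hV]; ring
  rw [hTV, ← hnorm, ← hnorm, hvmin]
  have hle : (⨅ w : K, ‖a - w‖) ≤ ‖a - L V‖ :=
    ciInf_le ⟨0, by rintro _ ⟨w, rfl⟩; exact norm_nonneg _⟩
      (⟨L V, Submodule.mem_map_of_mem hVk⟩ : K)
  exact pow_le_pow_left₀ (hvmin ▸ norm_nonneg _) hle 2

/-- The error bound for a residual filter `rootProd (a ::ₘ S)` with smallest root `a`, applied to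
noisy data `η = m + ξ`. Beyond `a` the filter is controlled through its values before `a`, by the
correlation `hcorr`; before `a` the identity
`((1 - R) ξ - R m)² + R (1 - R) (m + ξ)² = (1 - R) ξ² + R m²` separates signal and noise. -/
theorem sum_sq_noise_sub_residual_le {m ξ : ι → ℝ} (hη : ∀ j, η j = m j + ξ j)
    (hμ : ∀ j, 0 ≤ μ j) {a : ℝ} {S : Multiset ℝ} (ha : 0 < a) (haS : ∀ b ∈ S, a ≤ b)
    (hcorr : 0 ≤ ∑ j, (rootProd (a ::ₘ S)).eval (μ j) * (rootProd S).eval (μ j) *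
      (μ j * η j ^ 2))
    {θ : ℝ} (hθ : θ = ((a ::ₘ S).map fun b => b⁻¹).sum) :
    ∑ j, (ξ j - (rootProd (a ::ₘ S)).eval (μ j) * η j) ^ 2 ≤
      2 * ∑ j, (Real.exp (-(θ * μ j)) * m j ^ 2 + min 1 (θ * μ j) * ξ j ^ 2) := by
  have hpos : ∀ b ∈ a ::ₘ S, 0 < b := by
    intro b hb
    rcases Multiset.mem_cons.1 hb with rfl | hb
    · exact ha
    · exact ha.trans_le (haS b hb)
  have hθa : a⁻¹ ≤ θ := by
    rw [hθ, Multiset.map_cons, Multiset.sum_cons, le_add_iff_nonneg_right]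
    refine Multiset.sum_nonneg fun z hz => ?_
    obtain ⟨b, hb, rfl⟩ := Multiset.mem_map.1 hz
    exact (inv_pos.2 (ha.trans_le (haS b hb))).le
  -- termwise, the claim holds up to the nonpositive multiple `-2 / a` of the correlation
  have hterm : ∀ j, (ξ j - (rootProd (a ::ₘ S)).eval (μ j) * η j) ^ 2 ≤
      2 * (Real.exp (-(θ * μ j)) * m j ^ 2 + min 1 (θ * μ j) * ξ j ^ 2) -
        2 * a⁻¹ * ((rootProd (a ::ₘ S)).eval (μ j) * (rootProd S).eval (μ j) *
          (μ j * η j ^ 2)) := by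
    intro j
    have hR : (rootProd (a ::ₘ S)).eval (μ j) = (1 - a⁻¹ * μ j) * (rootProd S).eval (μ j) := by
      simp
    set z := a⁻¹ * μ j with hz
    have hz0 : 0 ≤ z := mul_nonneg (inv_pos.2 ha).le (hμ j)
    have hcorr_eq : 2 * a⁻¹ * ((rootProd (a ::ₘ S)).eval (μ j) * (rootProd S).eval (μ j) *
        (μ j * η j ^ 2)) =
        2 * z * (rootProd (a ::ₘ S)).eval (μ j) * (rootProd S).eval (μ j) * η j ^ 2 := by
      rw [hz]; ring
    rw [hcorr_eq]
    rcases le_or_gt a (μ j) with haj | haj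
    · have hz1 : 1 ≤ z := by rw [hz, le_inv_mul_iff₀ ha]; simpa using haj
      have hmin : min 1 (θ * μ j) = 1 := by
        refine min_eq_left (hz1.trans ?_)
        exact mul_le_mul_of_nonneg_right hθa (hμ j)
      rw [hmin, hR]
      set q := (rootProd S).eval (μ j)
      have h1 : 0 ≤ Real.exp (-(θ * μ j)) * m j ^ 2 := by positivity
      have h2 : 0 ≤ (z - 1) * (q * η j) ^ 2 := mul_nonneg (by linarith) (sq_nonneg _)
      nlinarith [sq_nonneg (ξ j + (1 - z) * q * η j)]
    · have hz1 : z ≤ 1 := by rw [hz, inv_mul_le_iff₀ ha]; simpa using haj.le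
      obtain ⟨b1, b2, b3, b4⟩ := rootProd_bounds (hμ j) hpos (by
        intro b hb
        rcases Multiset.mem_cons.1 hb with rfl | hb
        · exact haj.le
        · exact haj.le.trans (haS b hb))
      obtain ⟨c1, c2, -, -⟩ := rootProd_bounds (S := S) (hμ j)
        (fun b hb => ha.trans_le (haS b hb)) (fun b hb => haj.le.trans (haS b hb))
      rw [← hθ] at b3 b4
      set r := (rootProd (a ::ₘ S)).eval (μ j)
      set q := (rootProd S).eval (μ j)
      have h1 : r * m j ^ 2 ≤ Real.exp (-(θ * μ j)) * m j ^ 2 :=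
        mul_le_mul_of_nonneg_right b3 (sq_nonneg _)
      have h2 : (1 - r) * ξ j ^ 2 ≤ min 1 (θ * μ j) * ξ j ^ 2 :=
        mul_le_mul_of_nonneg_right (le_min (by linarith) b4) (sq_nonneg _)
      have h3 : z * q ≤ 1 - r := by rw [hR]; nlinarith
      have h4 : r * η j ^ 2 * (z * q) ≤ r * η j ^ 2 * (1 - r) :=
        mul_le_mul_of_nonneg_left h3 (mul_nonneg b1 (sq_nonneg _))
      have h5 : (ξ j - r * η j) ^ 2 + r * (1 - r) * η j ^ 2 =
          (1 - r) * ξ j ^ 2 + r * m j ^ 2 := by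
        rw [hη j]; ring
      nlinarith [sq_nonneg (ξ j - r * η j)]
  refine (Finset.sum_le_sum fun j _ => hterm j).trans ?_
  rw [Finset.sum_sub_distrib, ← Finset.mul_sum, ← Finset.mul_sum]
  have := mul_nonneg (mul_nonneg zero_le_two (inv_pos.2 ha).le) hcorr
  linarith

end CG

/-! ### Eigen-coordinates of the empirical covariance matrix -/

section Eigen

variable {n p : ℕ}

/-- The eigenvalue of `Σ̂` at an index in `Fin p`. -/
noncomputable def eigVal (X : Matrix (Fin n) (Fin p) ℝ) (j : Fin p) : ℝ :=
  (sigmaHat_isHermitian X).eigenvalues j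

/-- The eigenvector of `Σ̂` belonging to `eigVal X j`, from an orthonormal basis. -/
noncomputable def eigVec (X : Matrix (Fin n) (Fin p) ℝ) (j : Fin p) : Fin p → ℝ :=
  WithLp.ofLp ((sigmaHat_isHermitian X).eigenvectorBasis j)

/-- The coordinate of `v` with respect to the eigenvector `eigVec X j`. -/
noncomputable def coord (X : Matrix (Fin n) (Fin p) ℝ) (v : Fin p → ℝ) (j : Fin p) : ℝ :=
  v ⬝ᵥ eigVec X j

theorem coord_add (X : Matrix (Fin n) (Fin p) ℝ) (v w : Fin p → ℝ) (j : Fin p) :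
    coord X (v + w) j = coord X v j + coord X w j := add_dotProduct _ _ _

theorem coord_sub (X : Matrix (Fin n) (Fin p) ℝ) (v w : Fin p → ℝ) (j : Fin p) :
    coord X (v - w) j = coord X v j - coord X w j := sub_dotProduct _ _ _

theorem coord_smul (X : Matrix (Fin n) (Fin p) ℝ) (c : ℝ) (v : Fin p → ℝ) (j : Fin p) :
    coord X (c • v) j = c * coord X v j := smul_dotProduct _ _ _

theorem dotProduct_eq_sum_coord (X : Matrix (Fin n) (Fin p) ℝ) (v w : Fin p → ℝ) :
    v ⬝ᵥ w = ∑ j, coord X v j * coord X w j := by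
  have h := (sigmaHat_isHermitian X).eigenvectorBasis.sum_inner_mul_inner
    (WithLp.toLp 2 w) (WithLp.toLp 2 v)
  simp only [EuclideanSpace.inner_eq_star_dotProduct, star_trivial] at h
  rw [← h]
  refine Finset.sum_congr rfl fun j _ => ?_
  rw [mul_comm, dotProduct_comm (WithLp.ofLp _) w]
  rfl

theorem sqNorm_eq_sum_coord (X : Matrix (Fin n) (Fin p) ℝ) (v : Fin p → ℝ) :
    sqNorm v = ∑ j, coord X v j ^ 2 := by
  have h := dotProduct_eq_sum_coord X v v
  simpa [sqNorm, dotProduct, ← sq] using h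

theorem coord_fcalc (X : Matrix (Fin n) (Fin p) ℝ) (lam : ℝ) (f : ℝ → ℝ) (v : Fin p → ℝ)
    (j : Fin p) : coord X ((fcalc X lam f).mulVec v) j = f (eigVal X j + lam) * coord X v j := by
  have hU : ∀ w : Fin p → ℝ,
      (star ((sigmaHat_isHermitian X).eigenvectorUnitary : Matrix (Fin p) (Fin p) ℝ)).mulVec w =
        coord X w := by
    intro w
    ext i
    rw [coord, dotProduct_comm]
    rfl
  rw [← hU, ← hU, fcalc, Matrix.IsHermitian.cfc, Unitary.conjStarAlgAut_apply,
    Matrix.mulVec_mulVec, ← mul_assoc, ← mul_assoc, Unitary.coe_star_mul_self, one_mul,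
    ← Matrix.mulVec_mulVec, Matrix.mulVec_diagonal]
  rfl

theorem coord_sigmaHat (X : Matrix (Fin n) (Fin p) ℝ) (v : Fin p → ℝ) (j : Fin p) :
    coord X ((sigmaHat X).mulVec v) j = eigVal X j * coord X v j := by
  have hs : (sigmaHat X).transpose = sigmaHat X := by
    have := sigmaHat_isHermitian X
    rwa [Matrix.IsHermitian, Matrix.conjTranspose_eq_transpose_of_trivial] at this
  have h := (sigmaHat_isHermitian X).mulVec_eigenvectorBasis j
  rw [coord, coord, dotProduct_comm, Matrix.dotProduct_mulVec, ← Matrix.mulVec_transpose, hs]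
  change ((sigmaHat X).mulVec (WithLp.ofLp ((sigmaHat_isHermitian X).eigenvectorBasis j))) ⬝ᵥ v = _
  rw [h, smul_dotProduct, dotProduct_comm]
  rfl

theorem coord_sigmaLam (X : Matrix (Fin n) (Fin p) ℝ) (lam : ℝ) (v : Fin p → ℝ) (j : Fin p) :
    coord X ((sigmaLam X lam).mulVec v) j = (eigVal X j + lam) * coord X v j := by
  rw [sigmaLam, Matrix.add_mulVec, coord_add, coord_sigmaHat, Matrix.smul_mulVec, coord_smul,
    Matrix.one_mulVec]
  ring

theorem coord_transpose_mulVec (X : Matrix (Fin n) (Fin p) ℝ) (z : Fin n → ℝ) (j : Fin p) :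
    coord X (X.transpose.mulVec z) j = z ⬝ᵥ X.mulVec (eigVec X j) := by
  rw [coord, Matrix.mulVec_transpose, Matrix.dotProduct_mulVec]

theorem sqNorm_mulVec_eigVec (X : Matrix (Fin n) (Fin p) ℝ) (hn : 0 < n) (j : Fin p) :
    sqNorm (X.mulVec (eigVec X j)) = n * eigVal X j := by
  have hself : eigVec X j ⬝ᵥ eigVec X j = 1 := by
    have h := (sigmaHat_isHermitian X).eigenvectorBasis.orthonormal.1 j
    have h2 := real_inner_self_eq_norm_sq ((sigmaHat_isHermitian X).eigenvectorBasis j)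
    rw [h, EuclideanSpace.inner_eq_star_dotProduct] at h2
    simpa [eigVec] using h2
  have h1 := coord_sigmaHat X (eigVec X j) j
  have h2 : coord X (eigVec X j) j = 1 := hself
  rw [h2, sigmaHat, Matrix.smul_mulVec, coord_smul, ← Matrix.mulVec_mulVec,
    coord_transpose_mulVec] at h1
  have hn' : (n : ℝ) ≠ 0 := by exact_mod_cast hn.ne'
  have h3 : sqNorm (X.mulVec (eigVec X j)) =
      X.mulVec (eigVec X j) ⬝ᵥ X.mulVec (eigVec X j) := by
    simp [sqNorm, dotProduct, sq]
  rw [h3]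
  field_simp at h1
  linarith

theorem eigVal_nonneg (X : Matrix (Fin n) (Fin p) ℝ) (hn : 0 < n) (j : Fin p) :
    0 ≤ eigVal X j := by
  have h := sqNorm_mulVec_eigVec X hn j
  have h1 : 0 ≤ sqNorm (X.mulVec (eigVec X j)) := Finset.sum_nonneg fun i _ => sq_nonneg _
  have hn' : (0 : ℝ) < n := by exact_mod_cast hn
  rw [h] at h1
  exact nonneg_of_mul_nonneg_right h1 hn'

/-- Eigen-coordinates of the transformed data. -/
theorem coord_yLam (X : Matrix (Fin n) (Fin p) ℝ) (y : Fin n → ℝ) (lam : ℝ) (j : Fin p) :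
    coord X (yLam X y lam) j =
      (n : ℝ)⁻¹ * ((Real.sqrt (eigVal X j + lam))⁻¹ * coord X (X.transpose.mulVec y) j) := by
  rw [yLam, coord_smul, invSqrtSigma, coord_fcalc]

theorem sqrt_mul_inv (x : ℝ) : Real.sqrt x * x⁻¹ = (Real.sqrt x)⁻¹ := by
  rcases le_or_gt x 0 with h | h
  · simp [Real.sqrt_eq_zero_of_nonpos h]
  · have := Real.sq_sqrt h.le
    have h2 := Real.sqrt_pos.2 h
    field_simp
    exact this

/-- Signal plus noise decomposition of the transformed data in eigen-coordinates. -/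
theorem coord_yLam_eq_add (X : Matrix (Fin n) (Fin p) ℝ) (y : Fin n → ℝ) (β₀ : Fin p → ℝ)
    (lam : ℝ) (j : Fin p) :
    coord X (yLam X y lam) j = Real.sqrt (eigVal X j + lam) * coord X (betaLam X β₀ lam) j +
      (n : ℝ)⁻¹ * (Real.sqrt (eigVal X j + lam))⁻¹ *
        ((y - X.mulVec β₀) ⬝ᵥ X.mulVec (eigVec X j)) := by
  have h1 : coord X (betaLam X β₀ lam) j =
      (eigVal X j + lam)⁻¹ * coord X ((sigmaHat X).mulVec β₀) j := by
    rw [betaLam, invSigma, coord_fcalc]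
  have h2 : coord X ((sigmaHat X).mulVec β₀) j =
      (n : ℝ)⁻¹ * (X.mulVec β₀ ⬝ᵥ X.mulVec (eigVec X j)) := by
    rw [sigmaHat, Matrix.smul_mulVec, coord_smul, ← Matrix.mulVec_mulVec, coord_transpose_mulVec]
  rw [coord_yLam, h1, ← mul_assoc (Real.sqrt _), sqrt_mul_inv, h2,
    coord_transpose_mulVec, sub_dotProduct]
  ring

theorem mulVec_eigVec_eq_zero (X : Matrix (Fin n) (Fin p) ℝ) (hn : 0 < n) {j : Fin p}
    (hj : eigVal X j = 0) : X.mulVec (eigVec X j) = 0 := by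
  have h := sqNorm_mulVec_eigVec X hn j
  rw [hj, mul_zero, sqNorm, Finset.sum_eq_zero_iff_of_nonneg fun i _ => sq_nonneg _] at h
  ext i
  exact pow_eq_zero_iff two_ne_zero |>.1 (h i (Finset.mem_univ i))

theorem coord_yLam_eq_zero (X : Matrix (Fin n) (Fin p) ℝ) (hn : 0 < n) (y : Fin n → ℝ) (lam : ℝ)
    {j : Fin p} (hj : eigVal X j = 0) : coord X (yLam X y lam) j = 0 := by
  rw [coord_yLam, coord_transpose_mulVec, mulVec_eigVec_eq_zero X hn hj, dotProduct_zero]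
  ring

theorem loss_filterEst (X : Matrix (Fin n) (Fin p) ℝ) (y : Fin n → ℝ) (lam : ℝ)
    (γ : Fin p → ℝ) (R : ℝ → ℝ) :
    loss X lam γ (filterEst X y lam R) = ∑ j, ((1 - R (eigVal X j + lam)) *
      coord X (yLam X y lam) j - Real.sqrt (eigVal X j + lam) * coord X γ j) ^ 2 := by
  rw [loss, sqNorm_eq_sum_coord X]
  refine Finset.sum_congr rfl fun j _ => ?_
  congr 1
  rw [sqrtSigma, coord_fcalc, coord_sub, filterEst, invSqrtSigma, coord_fcalc, Matrix.sub_mulVec,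
    Matrix.one_mulVec, coord_sub, coord_fcalc]
  by_cases h : Real.sqrt (eigVal X j + lam) = 0
  · rw [coord_yLam, h]
    simp
  · field_simp

theorem sqNorm_fcalc_yLam (X : Matrix (Fin n) (Fin p) ℝ) (y : Fin n → ℝ) (lam : ℝ) (R : ℝ → ℝ) :
    sqNorm ((fcalc X lam R).mulVec (yLam X y lam)) =
      ∑ j, (R (eigVal X j + lam) * coord X (yLam X y lam) j) ^ 2 := by
  rw [sqNorm_eq_sum_coord X]
  simp only [coord_fcalc]

theorem gammaCond_iff (X : Matrix (Fin n) (Fin p) ℝ) (β₀ γ : Fin p → ℝ) (lam t : ℝ)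
    (hμ : ∀ j, 0 ≤ eigVal X j + lam) :
    GammaCond X β₀ lam (2 * t) γ ↔
      0 ≤ ∑ j, Real.exp (-t * (eigVal X j + lam)) *
        (Real.sqrt (eigVal X j + lam) * coord X (betaLam X β₀ lam) j) *
        (Real.sqrt (eigVal X j + lam) * coord X γ j -
          Real.sqrt (eigVal X j + lam) * coord X (betaLam X β₀ lam) j) := by
  rw [GammaCond, dotProduct_eq_sum_coord X]
  refine iff_of_eq (congrArg _ (Finset.sum_congr rfl fun j _ => ?_))
  rw [coord_sigmaLam, coord_fcalc, coord_sub]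
  have h := Real.mul_self_sqrt (hμ j)
  have he : -(2 * t) * (eigVal X j + lam) / 2 = -t * (eigVal X j + lam) := by ring
  rw [he]
  nth_rewrite 1 [← h]
  ring

theorem residualPoly_isMinimalResidual (X : Matrix (Fin n) (Fin p) ℝ) (y : Fin n → ℝ) (lam : ℝ)
    (k : ℕ) : IsMinimalResidual (fun j => eigVal X j + lam) (coord X (yLam X y lam)) k
      (residualPoly X y lam k) := by
  have key : ∀ P, IsResidualPoly X y lam k P ↔
      IsMinimalResidual (fun j => eigVal X j + lam) (coord X (yLam X y lam)) k P := by
    intro P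
    simp only [IsResidualPoly, IsMinimalResidual, sqNorm_fcalc_yLam]
  have hex : ∃ P, IsResidualPoly X y lam k P := by
    simp only [key]
    exact exists_isMinimalResidual _ _ _
  rw [residualPoly, dif_pos hex, ← key]
  exact hex.choose_spec

/-- On nondegenerate data, the transformed data charge exactly the (shifted) distinct nonzero
eigenvalues. -/
theorem activePoints_of_nondegenerate (X : Matrix (Fin n) (Fin p) ℝ) (hn : 0 < n) {y : Fin n → ℝ}
    {lam : ℝ} (hlam : 0 ≤ lam) (hnd : Nondegenerate X y) :
    activePoints (fun j => eigVal X j + lam) (coord X (yLam X y lam)) =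
      ((Finset.univ.image (eigVal X)).filter (fun s => 0 < s)).image (· + lam) := by
  ext a
  simp only [mem_activePoints, Finset.mem_image, Finset.mem_filter, Finset.mem_univ, true_and]
  constructor
  · rintro ⟨j, hj, rfl⟩
    refine ⟨_, ⟨⟨j, rfl⟩, (eigVal_nonneg X hn j).lt_of_ne' fun h => hj ?_⟩, rfl⟩
    exact coord_yLam_eq_zero X hn y lam h
  · rintro ⟨s, ⟨⟨i, rfl⟩, hi⟩, rfl⟩
    have hsum := hnd i hi
    obtain ⟨j, hj, hne⟩ := Finset.exists_ne_zero_of_sum_ne_zero hsum.ne'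
    have hji : eigVal X j = eigVal X i := (Finset.mem_filter.1 hj).2
    have hc : coord X (X.transpose.mulVec y) j ≠ 0 := fun h => hne (by
      change coord X (X.transpose.mulVec y) j ^ 2 = 0
      rw [h]; ring)
    refine ⟨j, ?_, by rw [hji]⟩
    have hpos : 0 < eigVal X j + lam := by linarith
    have hn' : (n : ℝ) ≠ 0 := by exact_mod_cast hn.ne'
    rw [coord_yLam]
    exact mul_ne_zero (inv_ne_zero hn')
      (mul_ne_zero (inv_ne_zero (Real.sqrt_pos.2 hpos).ne') hc)

theorem card_activePoints_of_nondegenerate (X : Matrix (Fin n) (Fin p) ℝ) (hn : 0 < n)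
    {y : Fin n → ℝ} {lam : ℝ} (hlam : 0 ≤ lam) (hnd : Nondegenerate X y) :
    (activePoints (fun j => eigVal X j + lam) (coord X (yLam X y lam))).card = termIndex X := by
  rw [activePoints_of_nondegenerate X hn hlam hnd,
    Finset.card_image_of_injective _ (add_left_injective lam)]
  rfl

theorem sum_eigVal_eq_sum_eig (X : Matrix (Fin n) (Fin p) ℝ) (f : ℝ → ℝ) :
    ∑ j, f (eigVal X j) = ∑ j ∈ Finset.Icc 1 p, f (eig X j) := by
  have h1 : ∑ j, f (eigVal X j) =
      ∑ i : Fin (Fintype.card (Fin p)), f ((sigmaHat_isHermitian X).eigenvalues₀ i) := by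
    refine Fintype.sum_equiv (Fintype.equivOfCardEq (Fintype.card_fin _)).symm _ _ fun j => rfl
  rw [h1]
  refine Finset.sum_bij (fun i _ => i.1 + 1) ?_ ?_ ?_ ?_
  · intro i _
    have := i.2.trans_eq (Fintype.card_fin p)
    simp
    omega
  · intro i _ j _ h
    exact Fin.ext (by simpa using h)
  · intro j hj
    rw [Finset.mem_Icc] at hj
    exact ⟨⟨j - 1, by rw [Fintype.card_fin]; omega⟩, Finset.mem_univ _, by simp; omega⟩
  · intro i _
    have := i.2.trans_eq (Fintype.card_fin p)
    rw [eig, dif_pos ⟨by omega, by omega⟩]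
    simp

theorem eig_antitone (X : Matrix (Fin n) (Fin p) ℝ) {i j : ℕ} (hi : 1 ≤ i) (hij : i ≤ j)
    (hj : j ≤ p) : eig X j ≤ eig X i := by
  rw [eig, eig, dif_pos ⟨by omega, hj⟩, dif_pos ⟨hi, by omega⟩]
  exact (sigmaHat_isHermitian X).eigenvalues₀_antitone (Fin.mk_le_mk.2 (by omega))

theorem eig_nonneg (X : Matrix (Fin n) (Fin p) ℝ) (hn : 0 < n) (j : ℕ) : 0 ≤ eig X j := by
  rw [eig]
  split_ifs with h
  · have h1 := eigVal_nonneg X hn ((Fintype.equivOfCardEq (Fintype.card_fin _))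
      (⟨j - 1, by rw [Fintype.card_fin]; omega⟩ : Fin (Fintype.card (Fin p))))
    simpa [eigVal, Matrix.IsHermitian.eigenvalues] using h1
  · exact le_rfl

end Eigen

/-! ### The spectral constant -/

section Spectral

variable {n p : ℕ}

theorem two_mul_pos_of_le {a t : ℝ} (h1 : 0 < a) (ht : 1 / (2 * a) ≤ t) :
    0 < 2 * t ∧ 1 ≤ 2 * t * a := by
  have h2 : 0 < t := lt_of_lt_of_le (by positivity) ht
  rw [div_le_iff₀ (by positivity)] at ht
  exact ⟨by positivity, by linarith⟩

/-- The spectral index separates the eigenvalues with `2 t (s_j + lam) ≥ 1` from the others. -/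
theorem specIndex_spec (X : Matrix (Fin n) (Fin p) ℝ) (hp : 0 < p) {lam t : ℝ}
    (h1 : 0 < eig X 1 + lam) (ht : 1 / (2 * (eig X 1 + lam)) ≤ t)
    (hlt : 2 * t * (eig X p + lam) < 1) :
    2 ≤ specIndex X lam t ∧ specIndex X lam t ≤ p ∧
      2 * t * (eig X (specIndex X lam t) + lam) < 1 ∧
      ∀ j, 1 ≤ j → j < specIndex X lam t → 1 ≤ 2 * t * (eig X j + lam) := by
  obtain ⟨hθ, hθ1⟩ := two_mul_pos_of_le h1 ht
  have key : ∀ j, eig X j < (2 * t)⁻¹ - lam ↔ 2 * t * (eig X j + lam) < 1 := by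
    intro j
    rw [lt_sub_iff_add_lt, ← one_div, lt_div_iff₀ hθ, mul_comm]
  have hne : {j : ℕ | 1 ≤ j ∧ j ≤ p ∧ eig X j < (2 * t)⁻¹ - lam}.Nonempty :=
    ⟨p, hp, le_rfl, (key p).2 hlt⟩
  obtain ⟨m1, m2, m3⟩ := Nat.sInf_mem hne
  have hbelow : ∀ j, 1 ≤ j → j < specIndex X lam t → 1 ≤ 2 * t * (eig X j + lam) := by
    intro j hj hji
    by_contra hcon
    refine Nat.notMem_of_lt_sInf hji ⟨hj, ?_, (key j).2 (not_le.1 hcon)⟩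
    exact hji.le.trans m2
  refine ⟨?_, m2, (key _).1 m3, hbelow⟩
  change 1 ≤ specIndex X lam t at m1
  have m3' := (key _).1 m3
  change 2 * t * (eig X (specIndex X lam t) + lam) < 1 at m3'
  by_contra hcon
  have : specIndex X lam t = 1 := by omega
  rw [this] at m3'
  linarith

/-- The denominator of the spectral constant at index `i` and penalty `mu`. -/
noncomputable def specDenom (X : Matrix (Fin n) (Fin p) ℝ) (i : ℕ) (mu : ℝ) : ℝ :=
  ∑ j ∈ Finset.Ico 1 i, (eig X i + mu) * eig X j / (eig X j + mu) +
    ∑ j ∈ Finset.Icc i p, (eig X j + mu) * eig X j / (eig X (i - 1) + mu)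

theorem specDenom_nonneg (X : Matrix (Fin n) (Fin p) ℝ) (hn : 0 < n) (i : ℕ) {mu : ℝ}
    (hmu : 0 ≤ mu) : 0 ≤ specDenom X i mu := by
  have := eig_nonneg X hn
  refine add_nonneg (Finset.sum_nonneg fun j _ => ?_) (Finset.sum_nonneg fun j _ => ?_)
  · exact div_nonneg (mul_nonneg (add_nonneg (this i) hmu) (this j)) (add_nonneg (this j) hmu)
  · exact div_nonneg (mul_nonneg (add_nonneg (this j) hmu) (this j)) (add_nonneg (this _) hmu)

theorem eig_pos_of_sum_pos (X : Matrix (Fin n) (Fin p) ℝ) {i : ℕ} (hi : 1 ≤ i)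
    (hS : 0 < ∑ j ∈ Finset.Icc i p, eig X j) : 0 < eig X i := by
  by_contra hcon
  refine absurd hS (not_lt.2 (Finset.sum_nonpos fun j hj => ?_))
  rw [Finset.mem_Icc] at hj
  exact (eig_antitone X hi hj.1 hj.2).trans (not_lt.1 hcon)

theorem specDenom_pos (X : Matrix (Fin n) (Fin p) ℝ) (hn : 0 < n) {i : ℕ} (hi : 2 ≤ i)
    (hip : i ≤ p) {mu : ℝ} (hmu : 0 ≤ mu) (hS : 0 < ∑ j ∈ Finset.Icc i p, eig X j) :
    0 < specDenom X i mu := by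
  have hei := eig_pos_of_sum_pos X (by omega) hS
  have h0 := eig_nonneg X hn
  refine add_pos_of_pos_of_nonneg (Finset.sum_pos (fun j hj => ?_) ⟨1, ?_⟩)
    (Finset.sum_nonneg fun j _ => ?_)
  · rw [Finset.mem_Ico] at hj
    have hej : 0 < eig X j := hei.trans_le (eig_antitone X hj.1 hj.2.le hip)
    positivity
  · rw [Finset.mem_Ico]
    omega
  · exact div_nonneg (mul_nonneg (add_nonneg (h0 j) hmu) (h0 j)) (add_nonneg (h0 _) hmu)

theorem add_div_add_mono {a b mu : ℝ} (hab : a ≤ b) (hb : 0 < b) (hmu : 0 ≤ mu) :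
    a / b ≤ (a + mu) / (b + mu) := by
  rw [div_le_div_iff₀ hb (by linarith)]
  nlinarith

theorem specConst_nonneg (X : Matrix (Fin n) (Fin p) ℝ) (hn : 0 < n) (lam t : ℝ) {mu : ℝ}
    (hmu : 0 ≤ mu) : 0 ≤ specConst X lam mu t := by
  rw [specConst]
  split_ifs
  · exact mul_nonneg (Finset.sum_nonneg fun j _ => eig_nonneg X hn j)
      (inv_nonneg.2 (specDenom_nonneg X hn _ hmu))
  · exact le_rfl

theorem specConst_le_specConst_zero (X : Matrix (Fin n) (Fin p) ℝ) (hn : 0 < n) (hp : 0 < p)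
    {lam t : ℝ} (hlam : 0 ≤ lam) (h1 : 0 < eig X 1 + lam)
    (ht : 1 / (2 * (eig X 1 + lam)) ≤ t) : specConst X lam lam t ≤ specConst X lam 0 t := by
  rw [specConst, specConst]
  split_ifs with hlt
  swap
  · exact le_rfl
  obtain ⟨i2, ip, -, -⟩ := specIndex_spec X hp h1 ht hlt
  set i := specIndex X lam t
  have h0 := eig_nonneg X hn
  have hS0 : 0 ≤ ∑ j ∈ Finset.Icc i p, eig X j := Finset.sum_nonneg fun j _ => h0 j
  rcases hS0.eq_or_lt with hS | hS
  · rw [← hS, zero_mul, zero_mul]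
  have hei := eig_pos_of_sum_pos X (by omega) hS
  refine mul_le_mul_of_nonneg_left (inv_anti₀ (specDenom_pos X hn i2 ip le_rfl hS) ?_) hS0
  refine add_le_add (Finset.sum_le_sum fun j hj => ?_) (Finset.sum_le_sum fun j hj => ?_)
  · rw [Finset.mem_Ico] at hj
    have hle := eig_antitone X hj.1 hj.2.le ip
    have := mul_le_mul_of_nonneg_right
      (add_div_add_mono hle (hei.trans_le hle) hlam) (h0 j)
    rw [add_zero, add_zero]
    calc _ = eig X i / eig X j * eig X j := by ring
      _ ≤ _ := this
      _ = _ := by ring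
  · rw [Finset.mem_Icc] at hj
    have hle := eig_antitone X (show 1 ≤ i - 1 by omega) (show i - 1 ≤ j by omega) hj.2
    have hpos : 0 < eig X (i - 1) :=
      hei.trans_le (eig_antitone X (show 1 ≤ i - 1 by omega) (by omega) ip)
    have := mul_le_mul_of_nonneg_right (add_div_add_mono hle hpos hlam) (h0 j)
    rw [add_zero, add_zero]
    calc _ = eig X j / eig X (i - 1) * eig X j := by ring
      _ ≤ _ := this
      _ = _ := by ring

/-- The spectral constant compares the variance proxies with filters `min 1 (2 t x)` and
`(min 1 (2 t x))²`. -/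
theorem sum_min_le_specConst_mul (X : Matrix (Fin n) (Fin p) ℝ) (hn : 0 < n) (hp : 0 < p)
    {lam t : ℝ} (hlam : 0 ≤ lam) (h1 : 0 < eig X 1 + lam)
    (ht : 1 / (2 * (eig X 1 + lam)) ≤ t) :
    ∑ j, min 1 (2 * t * (eigVal X j + lam)) * (eigVal X j / (eigVal X j + lam)) ≤
      (1 + specConst X lam lam t) *
        ∑ j, min 1 (2 * t * (eigVal X j + lam)) ^ 2 * (eigVal X j / (eigVal X j + lam)) := by
  rw [sum_eigVal_eq_sum_eig X fun s => min 1 (2 * t * (s + lam)) * (s / (s + lam)),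
    sum_eigVal_eq_sum_eig X fun s => min 1 (2 * t * (s + lam)) ^ 2 * (s / (s + lam))]
  obtain ⟨hθ, -⟩ := two_mul_pos_of_le h1 ht
  have h0 := eig_nonneg X hn
  by_cases hlt : 2 * t * (eig X p + lam) < 1
  swap
  · have hC : specConst X lam lam t = 0 := by rw [specConst]; exact if_neg hlt
    rw [hC, add_zero, one_mul]
    refine Finset.sum_le_sum fun j hj => ?_
    rw [Finset.mem_Icc] at hj
    have hle := mul_le_mul_of_nonneg_left
      (add_le_add_left (eig_antitone X hj.1 hj.2 le_rfl) lam) hθ.le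
    rw [min_eq_left ((not_lt.1 hlt).trans hle)]
    simp
  have hC : specConst X lam lam t = (∑ j ∈ Finset.Icc (specIndex X lam t) p, eig X j) *
      (specDenom X (specIndex X lam t) lam)⁻¹ := by rw [specConst]; exact if_pos hlt
  have hCnn := specConst_nonneg X hn lam t hlam
  obtain ⟨i2, ip, hi, hbelow⟩ := specIndex_spec X hp h1 ht hlt
  set i := specIndex X lam t
  set θ := 2 * t
  have hsplit : ∀ f : ℕ → ℝ, ∑ j ∈ Finset.Icc 1 p, f j =
      ∑ j ∈ Finset.Ico 1 i, f j + ∑ j ∈ Finset.Icc i p, f j := by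
    intro f
    rw [← Finset.Ico_add_one_right_eq_Icc, ← Finset.Ico_add_one_right_eq_Icc,
      Finset.sum_Ico_consecutive f (by omega) (by omega)]
  have habove : ∀ j ∈ Finset.Icc i p, min 1 (θ * (eig X j + lam)) = θ * (eig X j + lam) := by
    intro j hj
    rw [Finset.mem_Icc] at hj
    have hle := mul_le_mul_of_nonneg_left
      (add_le_add_left (eig_antitone X (by omega) hj.1 hj.2) lam) hθ.le
    exact min_eq_right (hle.trans hi.le)
  have hmin1 : ∀ j ∈ Finset.Ico 1 i, min 1 (θ * (eig X j + lam)) = 1 := by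
    intro j hj
    rw [Finset.mem_Ico] at hj
    exact min_eq_left (hbelow j hj.1 hj.2)
  have hcancel : ∀ j, (eig X j + lam) * (eig X j / (eig X j + lam)) = eig X j := by
    intro j
    by_cases h : eig X j + lam = 0
    · have : eig X j = 0 := by linarith [h0 j]
      simp [this]
    · field_simp
  set A := ∑ j ∈ Finset.Ico 1 i, eig X j / (eig X j + lam) with hA
  set B := ∑ j ∈ Finset.Icc i p, (eig X j + lam) * eig X j with hB
  set S := ∑ j ∈ Finset.Icc i p, eig X j with hS
  have e1 : ∑ j ∈ Finset.Icc 1 p, min 1 (θ * (eig X j + lam)) * (eig X j / (eig X j + lam)) =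
      A + θ * S := by
    rw [hsplit, hA, hS, Finset.mul_sum]
    congr 1
    · exact Finset.sum_congr rfl fun j hj => by rw [hmin1 j hj, one_mul]
    · exact Finset.sum_congr rfl fun j hj => by rw [habove j hj, mul_assoc, hcancel]
  have e2 : ∑ j ∈ Finset.Icc 1 p, min 1 (θ * (eig X j + lam)) ^ 2 *
      (eig X j / (eig X j + lam)) = A + θ ^ 2 * B := by
    rw [hsplit, hA, hB, Finset.mul_sum]
    congr 1
    · exact Finset.sum_congr rfl fun j hj => by rw [hmin1 j hj, one_pow, one_mul]
    · refine Finset.sum_congr rfl fun j hj => ?_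
      rw [habove j hj]
      calc _ = θ ^ 2 * ((eig X j + lam) * ((eig X j + lam) * (eig X j / (eig X j + lam)))) := by
            ring
        _ = _ := by rw [hcancel]
  have hA0 : 0 ≤ A := Finset.sum_nonneg fun j _ => div_nonneg (h0 j) (add_nonneg (h0 j) hlam)
  have hB0 : 0 ≤ B := Finset.sum_nonneg fun j _ => mul_nonneg (add_nonneg (h0 j) hlam) (h0 j)
  have hD : specDenom X i lam = (eig X i + lam) * A + B / (eig X (i - 1) + lam) := by
    rw [specDenom, hA, hB, Finset.mul_sum, Finset.sum_div]
    congr 1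
    exact Finset.sum_congr rfl fun j _ => by ring
  have hprev : 1 ≤ θ * (eig X (i - 1) + lam) := hbelow (i - 1) (by omega) (by omega)
  have hprevpos : 0 < eig X (i - 1) + lam := by
    by_contra hcon
    nlinarith
  have hθD : θ * specDenom X i lam ≤ A + θ ^ 2 * B := by
    have h2 : θ * (B / (eig X (i - 1) + lam)) ≤ θ ^ 2 * B := by
      rw [← mul_div_assoc, div_le_iff₀ hprevpos]
      calc θ * B = θ * B * 1 := by ring
        _ ≤ θ * B * (θ * (eig X (i - 1) + lam)) :=
            mul_le_mul_of_nonneg_left hprev (mul_nonneg hθ.le hB0)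
        _ = _ := by ring
    have h3 : θ * (eig X i + lam) * A ≤ 1 * A := mul_le_mul_of_nonneg_right hi.le hA0
    rw [hD]
    nlinarith
  have hCD : specConst X lam lam t * specDenom X i lam = S := by
    have hS0 : 0 ≤ S := Finset.sum_nonneg fun j _ => h0 j
    rcases hS0.eq_or_lt with h | h
    · rw [hC, ← h]
      ring
    · rw [hC]
      exact inv_mul_cancel_right₀ (specDenom_pos X hn i2 ip hlam h).ne' S
  rw [e1, e2]
  have h4 := mul_le_mul_of_nonneg_left hθD hCnn
  have h5 : θ * S = specConst X lam lam t * (θ * specDenom X i lam) := by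
    rw [← hCD]; ring
  have h6 : 0 ≤ θ ^ 2 * B := by positivity
  nlinarith

theorem one_sub_exp_neg_half_mul_min_le {x : ℝ} (hx : 0 ≤ x) :
    (1 - Real.exp (-(1 / 2))) * min 1 (2 * x) ≤ 1 - Real.exp (-x) := by
  have hc : 0 ≤ 1 - Real.exp (-(1 / 2)) := by
    have := Real.exp_le_one_iff.2 (show (-(1 / 2) : ℝ) ≤ 0 by norm_num)
    linarith
  rcases le_total 1 (2 * x) with h | h
  · rw [min_eq_left h, mul_one]
    have := Real.exp_le_exp.2 (show -x ≤ -(1 / 2) by linarith)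
    linarith
  · rw [min_eq_right h]
    -- convexity of the exponential on `[-1/2, 0]`
    have := convexOn_exp.2 (Set.mem_univ (0 : ℝ)) (Set.mem_univ (-(1 / 2) : ℝ))
      (show 0 ≤ 1 - 2 * x by linarith) (show 0 ≤ 2 * x by linarith) (by ring)
    simp only [smul_eq_mul, mul_zero, zero_add, Real.exp_zero, mul_one] at this
    rw [show 2 * x * -(1 / 2) = -x by ring] at this
    linarith

end Spectral

/-! ### Stopping conjugate gradients by the slope at zero -/

/-- A continuous function starting below the level `c` in absolute value has exactly this absolute
value at its hitting time of the level, unless the level is not reached up to the horizon `N`. -/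
theorem abs_eq_at_hitting_time {g : ℝ → ℝ} (hg : Continuous g) {N c : ℝ} (hN : 0 ≤ N)
    (h0 : |g 0| < c) {τ : ℝ} (hτ : τ = sInf ({u | 0 ≤ u ∧ u ≤ N ∧ c ≤ |g u|} ∪ {N})) :
    0 ≤ τ ∧ τ ≤ N ∧ (|g τ| = c ∨ (τ = N ∧ |g N| < c)) := by
  set T : Set ℝ := {u | 0 ≤ u ∧ u ≤ N ∧ c ≤ |g u|} ∪ {N} with hT
  have hclosed : IsClosed T := by
    refine IsClosed.union ?_ isClosed_singleton
    exact isClosed_Ici.inter (isClosed_Iic.inter (isClosed_le continuous_const hg.abs))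
  have hbdd : BddBelow T := by
    refine ⟨0, ?_⟩
    rintro u (hu | hu)
    · exact hu.1
    · rw [hu]; exact hN
  have hmem : τ ∈ T := hτ ▸ hclosed.csInf_mem ⟨N, Or.inr rfl⟩ hbdd
  have hτ0 : 0 ≤ τ := by
    rcases hmem with h | h
    · exact h.1
    · rw [h]; exact hN
  have hτN : τ ≤ N := hτ ▸ csInf_le hbdd (Or.inr rfl)
  refine ⟨hτ0, hτN, ?_⟩
  rcases lt_or_ge |g τ| c with hlt | hge
  · right
    rcases hmem with h | h
    · exact absurd h.2.2 (not_le.2 hlt)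
    · have : τ = N := h
      exact ⟨this, this ▸ hlt⟩
  · left
    obtain ⟨u, ⟨hu0, huτ⟩, hu⟩ : c ∈ (fun u => |g u|) '' Set.Icc 0 τ :=
      intermediate_value_Icc hτ0 hg.abs.continuousOn ⟨h0.le, hge⟩
    have hτu : τ ≤ u := hτ ▸ csInf_le hbdd (Or.inl ⟨hu0, huτ.trans hτN, hu.ge⟩)
    rw [show τ = u from le_antisymm hτu huτ]
    exact hu

theorem ceil_sub_one_bounds {u : ℝ} (hu : 0 < u) :
    0 < u - ((⌈u⌉₊ - 1 : ℕ) : ℝ) ∧ u - ((⌈u⌉₊ - 1 : ℕ) : ℝ) ≤ 1 := by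
  have h1 : 1 ≤ ⌈u⌉₊ := Nat.one_le_ceil_iff.2 hu
  have h2 : ((⌈u⌉₊ - 1 : ℕ) : ℝ) = ⌈u⌉₊ - 1 := by push_cast [h1]; ring
  rw [h2]
  have := Nat.le_ceil u
  have := Nat.ceil_lt_add_one hu.le
  constructor <;> linarith

/-- Closed form of the piecewise linear interpolation of a sequence on `[0, N]`, which makes its
continuity evident. -/
theorem piecewise_linear_eq_sum (d : ℕ → ℝ) {N : ℕ} {u : ℝ} (hu0 : 0 ≤ u) (hu : u ≤ N) :
    (1 - (u - ((⌈u⌉₊ - 1 : ℕ) : ℝ))) * d (⌈u⌉₊ - 1) +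
        (u - ((⌈u⌉₊ - 1 : ℕ) : ℝ)) * d (⌈u⌉₊ - 1 + 1) =
      d 0 + ∑ k ∈ Finset.range N, (d (k + 1) - d k) * max 0 (min 1 (u - k)) := by
  rcases hu0.eq_or_lt with rfl | hpos
  · have : ∑ k ∈ Finset.range N, (d (k + 1) - d k) * max 0 (min 1 (0 - (k : ℝ))) = 0 := by
      refine Finset.sum_eq_zero fun k _ => ?_
      have hk : (0 : ℝ) ≤ k := Nat.cast_nonneg k
      rw [max_eq_left ((min_le_right _ _).trans (by linarith)), mul_zero]
    rw [this]
    simp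
  obtain ⟨b1, b2⟩ := ceil_sub_one_bounds hpos
  have hKN : ⌈u⌉₊ - 1 < N := by
    have h1 : 1 ≤ ⌈u⌉₊ := Nat.one_le_ceil_iff.2 hpos
    have h2 : ⌈u⌉₊ ≤ N := Nat.ceil_le.2 hu
    omega
  set K := ⌈u⌉₊ - 1
  have hlow : ∑ k ∈ Finset.range K, (d (k + 1) - d k) * max 0 (min 1 (u - k)) = d K - d 0 := by
    rw [← Finset.sum_range_sub]
    refine Finset.sum_congr rfl fun k hk => ?_
    have : ((k + 1 : ℕ) : ℝ) ≤ K := by exact_mod_cast Finset.mem_range.1 hk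
    push_cast at this
    rw [min_eq_left (by linarith), max_eq_right zero_le_one, mul_one]
  have hhigh : ∑ k ∈ Finset.Ico (K + 1) N, (d (k + 1) - d k) * max 0 (min 1 (u - k)) = 0 := by
    refine Finset.sum_eq_zero fun k hk => ?_
    have : ((K + 1 : ℕ) : ℝ) ≤ k := by exact_mod_cast (Finset.mem_Ico.1 hk).1
    push_cast at this
    rw [max_eq_left ((min_le_right _ _).trans (by linarith)), mul_zero]
  rw [← Finset.sum_range_add_sum_Ico _ (Nat.succ_le_of_lt hKN), hhigh, Finset.sum_range_succ, hlow,
    min_eq_right b2, max_eq_right b1.le]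
  ring

section Stopping

variable {n p : ℕ}

theorem residualInterp_derivative (X : Matrix (Fin n) (Fin p) ℝ) (y : Fin n → ℝ) (lam u : ℝ) :
    (residualInterp X y lam u).derivative.eval 0 =
      (1 - (u - ((⌈u⌉₊ - 1 : ℕ) : ℝ))) *
          (residualPoly X y lam (⌈u⌉₊ - 1)).derivative.eval 0 +
        (u - ((⌈u⌉₊ - 1 : ℕ) : ℝ)) *
          (residualPoly X y lam (⌈u⌉₊ - 1 + 1)).derivative.eval 0 := by
  simp only [residualInterp, derivative_add, derivative_C_mul, eval_add, eval_mul, eval_C]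

theorem residualInterp_natCast (X : Matrix (Fin n) (Fin p) ℝ) (y : Fin n → ℝ) (lam : ℝ) (N : ℕ) :
    residualInterp X y lam N = residualPoly X y lam N := by
  rcases N with _ | N
  · simp [residualInterp]
  · simp only [residualInterp, Nat.ceil_natCast, Nat.add_sub_cancel]
    simp

theorem residualPoly_zero (X : Matrix (Fin n) (Fin p) ℝ) (y : Fin n → ℝ) (lam : ℝ) :
    residualPoly X y lam 0 = 1 := by
  obtain ⟨h1, h2, -⟩ := residualPoly_isMinimalResidual X y lam 0
  rw [← coeff_zero_eq_eval_zero] at h2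
  rw [eq_C_of_natDegree_le_zero h1, h2, C_1]

/-- At the index `τ_t`, either the slope of the residual polynomial at zero is `2 t` in absolute
value, or the iteration has terminated with a smaller slope. -/
theorem tau_spec (X : Matrix (Fin n) (Fin p) ℝ) (y : Fin n → ℝ) (lam : ℝ) {t : ℝ} (ht : 0 < t) :
    tau lam t X y ≤ termIndex X ∧
      ((0 < tau lam t X y ∧
        |(residualInterp X y lam (tau lam t X y)).derivative.eval 0| = 2 * t) ∨
      (tau lam t X y = termIndex X ∧
        |(residualPoly X y lam (termIndex X)).derivative.eval 0| < 2 * t)) := by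
  set N := termIndex X with hN
  set d : ℕ → ℝ := fun k => (residualPoly X y lam k).derivative.eval 0 with hd
  set g : ℝ → ℝ := fun u =>
    d 0 + ∑ k ∈ Finset.range N, (d (k + 1) - d k) * max 0 (min 1 (u - k)) with hg
  have heq : ∀ u : ℝ, 0 ≤ u → u ≤ N → (residualInterp X y lam u).derivative.eval 0 = g u :=
    fun u hu0 hu => (residualInterp_derivative X y lam u).trans (piecewise_linear_eq_sum d hu0 hu)
  have hgcont : Continuous g := by fun_prop
  have hN0 : (0 : ℝ) ≤ N := Nat.cast_nonneg N
  have hg0 : g 0 = 0 := by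
    have := residualInterp_natCast X y lam 0
    rw [Nat.cast_zero, residualPoly_zero] at this
    rw [← heq 0 le_rfl hN0, this, derivative_one, eval_zero]
  have hτ : tau lam t X y = sInf ({u | 0 ≤ u ∧ u ≤ (N : ℝ) ∧ 2 * t ≤ |g u|} ∪ {(N : ℝ)}) := by
    rw [tau]
    congr 2
    ext u
    refine and_congr_right fun hu0 => and_congr_right fun hu => ?_
    rw [heq u hu0 hu]
  obtain ⟨h0, h1, h2⟩ := abs_eq_at_hitting_time hgcont hN0
    (show |g 0| < 2 * t by rw [hg0, abs_zero]; positivity) hτ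
  refine ⟨h1, h2.imp (fun h => ⟨h0.lt_of_ne fun hz => ?_, ?_⟩) fun h => ⟨h.1, ?_⟩⟩
  · rw [← hz, hg0, abs_zero] at h
    linarith
  · rw [heq _ h0 h1, h]
  · rw [← residualInterp_natCast, heq _ hN0 le_rfl]
    exact h.2

theorem abs_rootProd_derivative_eval_zero {S : Multiset ℝ} (hS : ∀ a ∈ S, 0 < a) :
    |(rootProd S).derivative.eval 0| = (S.map fun a => a⁻¹).sum := by
  rw [rootProd_derivative_eval_zero, abs_neg, abs_of_nonneg]
  refine Multiset.sum_nonneg fun z hz => ?_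
  obtain ⟨b, hb, rfl⟩ := Multiset.mem_map.1 hz
  exact (inv_pos.2 (hS b hb)).le

/-- Pathwise bound for conjugate gradients stopped at `τ_t`: up to the factor `2`, they fit the
signal as well as gradient flow, and the noise with at most the filter `min 1 (2 t x)`. -/
theorem sum_sq_cg_error_le (X : Matrix (Fin n) (Fin p) ℝ) (hn : 0 < n) {y : Fin n → ℝ} {lam t : ℝ}
    (hlam : 0 ≤ lam) (ht : 0 < t) (hnd : Nondegenerate X y) {m ξ : Fin p → ℝ}
    (hη : ∀ j, coord X (yLam X y lam) j = m j + ξ j) (hξ : ∀ j, eigVal X j = 0 → ξ j = 0) :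
    ∑ j, (ξ j - (residualInterp X y lam (tau lam t X y)).eval (eigVal X j + lam) *
        coord X (yLam X y lam) j) ^ 2 ≤
      2 * ∑ j, (Real.exp (-(2 * t * (eigVal X j + lam))) * m j ^ 2 +
        min 1 (2 * t * (eigVal X j + lam)) * ξ j ^ 2) := by
  set μ : Fin p → ℝ := fun j => eigVal X j + lam
  set η : Fin p → ℝ := coord X (yLam X y lam)
  have hμnn : ∀ j, 0 ≤ μ j := fun j => add_nonneg (eigVal_nonneg X hn j) hlam
  have hμ : ∀ j, η j ≠ 0 → 0 < μ j := fun j hj => add_pos_of_pos_of_nonneg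
    ((eigVal_nonneg X hn j).lt_of_ne' fun h => hj (coord_yLam_eq_zero X hn y lam h)) hlam
  have hcard : (activePoints μ η).card = termIndex X :=
    card_activePoints_of_nondegenerate X hn hlam hnd
  have hmin := residualPoly_isMinimalResidual X y lam
  obtain ⟨hτN, hτ | ⟨hτ, hslope⟩⟩ := tau_spec X y lam ht
  · obtain ⟨hτ0, hslope⟩ := hτ
    set u := tau lam t X y
    obtain ⟨b1, b2⟩ := ceil_sub_one_bounds hτ0
    have hk : ⌈u⌉₊ - 1 + 1 ≤ (activePoints μ η).card := by
      rw [hcard]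
      have h1 : 1 ≤ ⌈u⌉₊ := Nat.one_le_ceil_iff.2 hτ0
      have h2 : ⌈u⌉₊ ≤ termIndex X := Nat.ceil_le.2 hτN
      omega
    obtain ⟨S, hS, hScard, hR⟩ := exists_interp_eq_rootProd hμ (hmin _) (hmin _) hk b1
    have hR' : residualInterp X y lam u = rootProd S := hR
    obtain ⟨a, haS, hamin⟩ := S.toFinset.exists_min_image id (by
      obtain ⟨b, hb⟩ := Multiset.card_pos_iff_exists_mem.1 (show 0 < S.card by omega)
      exact ⟨b, Multiset.mem_toFinset.2 hb⟩)
    rw [Multiset.mem_toFinset] at haS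
    obtain ⟨S', rfl⟩ := Multiset.exists_cons_of_mem haS
    have hcorr := interp_mul_cofactor_nonneg hμ (hmin (⌈u⌉₊ - 1)) (hmin _) (by omega) b2
      (fun b hb => hS b (Multiset.mem_cons_of_mem hb)) (by simpa using hScard)
    rw [hR] at hcorr
    rw [hR'] at hslope ⊢
    refine sum_sq_noise_sub_residual_le hη hμnn (hS a haS) (fun b hb => ?_) hcorr ?_
    · exact hamin b (Multiset.mem_toFinset.2 (Multiset.mem_cons_of_mem hb))
    · rw [← hslope, abs_rootProd_derivative_eval_zero hS]
  · -- after termination the data are fitted exactly, and all nonzero eigenvalues are at least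
    -- `1 / (2 t)`
    rw [hτ, residualInterp_natCast, Finset.mul_sum]
    refine Finset.sum_le_sum fun j _ => ?_
    rw [(hmin _).eval_mul_eq_zero hμ hcard.le j, sub_zero]
    have he : 0 ≤ Real.exp (-(2 * t * (eigVal X j + lam))) * m j ^ 2 := by positivity
    rcases (eigVal_nonneg X hn j).eq_or_lt with h | h
    · rw [hξ j h.symm]
      nlinarith
    obtain ⟨S, hS, -, hR⟩ := (hmin (termIndex X)).exists_eq_rootProd hμ hcard.ge
    have hmem : μ j ∈ activePoints μ η := by
      rw [activePoints_of_nondegenerate X hn hlam hnd]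
      exact Finset.mem_image_of_mem _ (Finset.mem_filter.2
        ⟨Finset.mem_image_of_mem _ (Finset.mem_univ j), h⟩)
    obtain ⟨i, hi, hij⟩ := mem_activePoints.1 hmem
    have hroot := ((hmin _).eval_mul_eq_zero hμ hcard.le i)
    have hroot' := (mul_eq_zero.1 hroot).resolve_right hi
    rw [hR, hij] at hroot'
    have hmemS := mem_of_eval_eq_zero hS hroot'
    have hle : (μ j)⁻¹ ≤ (S.map fun a => a⁻¹).sum := by
      refine Multiset.single_le_sum (fun z hz => ?_) _ (Multiset.mem_map_of_mem _ hmemS)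
      obtain ⟨b, hb, rfl⟩ := Multiset.mem_map.1 hz
      exact (inv_pos.2 (hS b hb)).le
    rw [hR, abs_rootProd_derivative_eval_zero hS] at hslope
    have h1 : 1 ≤ 2 * t * (eigVal X j + lam) := by
      have hpos : 0 < μ j := add_pos_of_pos_of_nonneg h hlam
      have h2 := hle.trans hslope.le
      rwa [inv_le_iff_one_le_mul₀ hpos] at h2
    rw [min_eq_left h1]
    nlinarith [sq_nonneg (ξ j)]

end Stopping

/-! ### Risk comparison -/

/-- First and second moments of linear forms in centred, uncorrelated errors. -/
theorem linear_form_moments {n : ℕ} (ν : Measure (Fin n → ℝ)) (c : Fin n → ℝ) {σ : ℝ}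
    (hint : ∀ i, Integrable (fun z : Fin n → ℝ => z i - c i) ν)
    (hint2 : ∀ i j, Integrable (fun z : Fin n → ℝ => (z i - c i) * (z j - c j)) ν)
    (hmean : ∀ i, ∫ z, (z i - c i) ∂ν = 0)
    (hcov : ∀ i j, ∫ z, (z i - c i) * (z j - c j) ∂ν = if i = j then σ ^ 2 else 0)
    (w : Fin n → ℝ) :
    Integrable (fun z => (z - c) ⬝ᵥ w) ν ∧ ∫ z, (z - c) ⬝ᵥ w ∂ν = 0 ∧
      Integrable (fun z => ((z - c) ⬝ᵥ w) ^ 2) ν ∧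
      ∫ z, ((z - c) ⬝ᵥ w) ^ 2 ∂ν = σ ^ 2 * sqNorm w := by
  have e1 : (fun z : Fin n → ℝ => (z - c) ⬝ᵥ w) = fun z => ∑ i, (z i - c i) * w i := rfl
  have e2 : (fun z : Fin n → ℝ => ((z - c) ⬝ᵥ w) ^ 2) =
      fun z => ∑ i, ∑ j, ((z i - c i) * (z j - c j)) * (w i * w j) := by
    ext z
    rw [sq, dotProduct, Finset.sum_mul_sum]
    refine Finset.sum_congr rfl fun i _ => Finset.sum_congr rfl fun j _ => ?_
    simp only [Pi.sub_apply]
    ring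
  refine ⟨?_, ?_, ?_, ?_⟩
  · rw [e1]
    exact integrable_finsetSum _ fun i _ => (hint i).mul_const _
  · rw [e1, integral_finsetSum _ fun i _ => (hint i).mul_const _]
    exact Finset.sum_eq_zero fun i _ => by rw [integral_mul_const, hmean, zero_mul]
  · rw [e2]
    exact integrable_finsetSum _ fun i _ => integrable_finsetSum _ fun j _ =>
      (hint2 i j).mul_const _
  · rw [e2, integral_finsetSum _ fun i _ => integrable_finsetSum _ fun j _ =>
      (hint2 i j).mul_const _, sqNorm, Finset.mul_sum]
    refine Finset.sum_congr rfl fun i _ => ?_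
    rw [integral_finsetSum _ fun j _ => (hint2 i j).mul_const _]
    simp only [integral_mul_const, hcov]
    simp [sq]

/-- The risk comparison for a fixed design, for a response distribution `ν` with the prescribed
first and second moments. -/
theorem lintegral_loss_cg_le {n p : ℕ} (hn : 0 < n) (hp : 0 < p) (X : Matrix (Fin n) (Fin p) ℝ)
    (β₀ γ : Fin p → ℝ) {σ lam t : ℝ} (hlam : 0 ≤ lam) (h1 : 0 < eig X 1 + lam)
    (ht : 1 / (2 * (eig X 1 + lam)) ≤ t) (hγ : GammaCond X β₀ lam (2 * t) γ)
    (ν : Measure (Fin n → ℝ)) [IsProbabilityMeasure ν]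
    (hint : ∀ i, Integrable (fun z : Fin n → ℝ => z i - X.mulVec β₀ i) ν)
    (hint2 : ∀ i j, Integrable (fun z : Fin n → ℝ =>
      (z i - X.mulVec β₀ i) * (z j - X.mulVec β₀ j)) ν)
    (hmean : ∀ i, ∫ z, (z i - X.mulVec β₀ i) ∂ν = 0)
    (hcov : ∀ i j, ∫ z, (z i - X.mulVec β₀ i) * (z j - X.mulVec β₀ j) ∂ν =
      if i = j then σ ^ 2 else 0)
    (hnd : ∀ᵐ z ∂ν, Nondegenerate X z) :
    ∫⁻ z, ENNReal.ofReal (loss X lam γ (cgAtTau lam t X z)) ∂ν ≤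
      ENNReal.ofReal (4 * (1 + specConst X lam lam t) / (1 - Real.exp (-(1 / 2))) ^ 2) *
        ∫⁻ z, ENNReal.ofReal (loss X lam γ (gradFlow lam t X z)) ∂ν := by
  have htpos : 0 < t := by linarith [(two_mul_pos_of_le h1 ht).1]
  have hμ : ∀ j, 0 ≤ eigVal X j + lam := fun j => add_nonneg (eigVal_nonneg X hn j) hlam
  set μ : Fin p → ℝ := fun j => eigVal X j + lam
  set m : Fin p → ℝ := fun j => Real.sqrt (μ j) * coord X (betaLam X β₀ lam) j
  set g : Fin p → ℝ := fun j => Real.sqrt (μ j) * coord X γ j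
  set a : Fin p → ℝ := fun j => (n : ℝ)⁻¹ * (Real.sqrt (μ j))⁻¹ with ha
  set L : Fin p → (Fin n → ℝ) → ℝ := fun j z => (z - X.mulVec β₀) ⬝ᵥ X.mulVec (eigVec X j) with hL
  set v : Fin p → ℝ := fun j => σ ^ 2 / n * (eigVal X j / μ j) with hv
  have hmom := fun j => linear_form_moments ν (X.mulVec β₀) hint hint2 hmean hcov
    (X.mulVec (eigVec X j))
  have hξint : ∀ j, Integrable (fun z => a j * L j z) ν := fun j => (hmom j).1.const_mul _
  have hξmean : ∀ j, ∫ z, a j * L j z ∂ν = 0 := fun j => by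
    rw [integral_const_mul, (hmom j).2.1, mul_zero]
  have hξint2 : ∀ j, Integrable (fun z => (a j * L j z) ^ 2) ν := fun j => by
    simp only [mul_pow]
    exact (hmom j).2.2.1.const_mul _
  have hξvar : ∀ j, ∫ z, (a j * L j z) ^ 2 ∂ν = v j := fun j => by
    simp only [mul_pow]
    rw [integral_const_mul, (hmom j).2.2.2, sqNorm_mulVec_eigVec X hn]
    have hn' : (n : ℝ) ≠ 0 := by exact_mod_cast hn.ne'
    rw [ha, hv]
    simp only [mul_pow, inv_pow, Real.sq_sqrt (show 0 ≤ μ j from hμ j)]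
    field_simp
  have hvnn : ∀ j, 0 ≤ v j := fun j =>
    mul_nonneg (by positivity) (div_nonneg (eigVal_nonneg X hn j) (hμ j))
  have hη : ∀ z j, coord X (yLam X z lam) j = m j + a j * L j z := fun z j =>
    coord_yLam_eq_add X z β₀ lam j
  have hξ0 : ∀ z j, eigVal X j = 0 → a j * L j z = 0 := by
    intro z j hj
    simp only [hL, mulVec_eigVec_eq_zero X hn hj, dotProduct_zero, mul_zero]
  -- the risk of gradient flow
  set E : Fin p → ℝ := fun j => Real.exp (-t * μ j) with hE
  have hGF : ∫⁻ z, ENNReal.ofReal (loss X lam γ (gradFlow lam t X z)) ∂ν =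
      ENNReal.ofReal (∑ j, (((1 - E j) * m j - g j) ^ 2 + (1 - E j) ^ 2 * v j)) := by
    have hloss : ∀ z, loss X lam γ (gradFlow lam t X z) =
        ∑ j, (((1 - E j) * m j - g j) ^ 2 +
          (2 * ((1 - E j) * m j - g j) * (1 - E j)) * (a j * L j z) +
          (1 - E j) ^ 2 * (a j * L j z) ^ 2) := by
      intro z
      rw [gradFlow, loss_filterEst]
      refine Finset.sum_congr rfl fun j _ => ?_
      rw [hη]
      ring
    have hi : ∀ j, Integrable (fun z => ((1 - E j) * m j - g j) ^ 2 +
          (2 * ((1 - E j) * m j - g j) * (1 - E j)) * (a j * L j z) +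
          (1 - E j) ^ 2 * (a j * L j z) ^ 2) ν := fun j =>
      ((integrable_const _).add ((hξint j).const_mul _)).add ((hξint2 j).const_mul _)
    have hnn : ∀ z, 0 ≤ loss X lam γ (gradFlow lam t X z) := fun z => by
      rw [loss, sqNorm]
      exact Finset.sum_nonneg fun _ _ => sq_nonneg _
    rw [← ofReal_integral_eq_lintegral_ofReal _ (Filter.Eventually.of_forall hnn)]
    · congr 1
      simp only [hloss]
      rw [integral_finsetSum _ fun j _ => hi j]
      refine Finset.sum_congr rfl fun j _ => ?_
      have hi1 : Integrable (fun z => ((1 - E j) * m j - g j) ^ 2 +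
          (2 * ((1 - E j) * m j - g j) * (1 - E j)) * (a j * L j z)) ν :=
        (integrable_const _).add ((hξint j).const_mul _)
      rw [integral_add hi1 ((hξint2 j).const_mul _),
        integral_add (integrable_const _) ((hξint j).const_mul _),
        integral_const_mul, hξmean, integral_const_mul, hξvar]
      simp
    · simp only [hloss]
      exact integrable_finsetSum _ fun j _ => hi j
  -- the risk of conjugate gradients
  have hCG : ∫⁻ z, ENNReal.ofReal (loss X lam γ (cgAtTau lam t X z)) ∂ν ≤
      ENNReal.ofReal (∑ j, (2 * (m j - g j) ^ 2 + 4 * (Real.exp (-(2 * t * μ j)) * m j ^ 2) +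
        4 * min 1 (2 * t * μ j) * v j)) := by
    have hi : ∀ j, Integrable (fun z => 2 * (m j - g j) ^ 2 +
        4 * (Real.exp (-(2 * t * μ j)) * m j ^ 2) +
        4 * min 1 (2 * t * μ j) * (a j * L j z) ^ 2) ν := fun j =>
      (integrable_const _).add ((hξint2 j).const_mul _)
    have hpt : ∀ᵐ z ∂ν, loss X lam γ (cgAtTau lam t X z) ≤ ∑ j, (2 * (m j - g j) ^ 2 +
        4 * (Real.exp (-(2 * t * μ j)) * m j ^ 2) +
        4 * min 1 (2 * t * μ j) * (a j * L j z) ^ 2) := by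
      filter_upwards [hnd] with z hz
      have hcg := sum_sq_cg_error_le X hn hlam htpos hz (hη z) (hξ0 z)
      rw [cgAtTau, cgEst, loss_filterEst]
      calc _ ≤ ∑ j, (2 * (m j - g j) ^ 2 + 2 * (a j * L j z -
              (residualInterp X z lam (tau lam t X z)).eval (μ j) *
                coord X (yLam X z lam) j) ^ 2) := by
            refine Finset.sum_le_sum fun j _ => ?_
            have h2 := add_sq_le (a := m j - g j) (b := a j * L j z -
              (residualInterp X z lam (tau lam t X z)).eval (μ j) * coord X (yLam X z lam) j)
            rw [← mul_add]
            refine le_trans (le_of_eq ?_) h2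
            rw [hη]
            ring
        _ ≤ ∑ j, 2 * (m j - g j) ^ 2 + 2 * (2 * ∑ j, (Real.exp (-(2 * t * μ j)) * m j ^ 2 +
              min 1 (2 * t * μ j) * (a j * L j z) ^ 2)) := by
            rw [Finset.sum_add_distrib, ← Finset.mul_sum Finset.univ (fun j => (_ - _) ^ 2) 2]
            rw [← Finset.mul_sum]
            linarith
        _ = _ := by
            rw [Finset.mul_sum, Finset.mul_sum, ← Finset.sum_add_distrib]
            refine Finset.sum_congr rfl fun j _ => ?_
            ring
    calc _ ≤ ∫⁻ z, ENNReal.ofReal (∑ j, (2 * (m j - g j) ^ 2 +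
          4 * (Real.exp (-(2 * t * μ j)) * m j ^ 2) +
          4 * min 1 (2 * t * μ j) * (a j * L j z) ^ 2)) ∂ν := by
          refine lintegral_mono_ae ?_
          filter_upwards [hpt] with z hz using ENNReal.ofReal_le_ofReal hz
      _ = _ := by
          rw [← ofReal_integral_eq_lintegral_ofReal (integrable_finsetSum _ fun j _ => hi j)]
          · congr 1
            rw [integral_finsetSum _ fun j _ => hi j]
            refine Finset.sum_congr rfl fun j _ => ?_
            rw [integral_add (integrable_const _) ((hξint2 j).const_mul _), integral_const_mul,
              hξvar]
            simp
          · refine Filter.Eventually.of_forall fun z => Finset.sum_nonneg fun j _ => ?_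
            have := mul_nonneg (mul_nonneg htpos.le zero_le_two) (hμ j)
            have : 0 ≤ min 1 (2 * t * μ j) := le_min zero_le_one (by linarith)
            positivity
  rw [hGF]
  refine hCG.trans ?_
  -- comparison of the two bounds
  set κ := 1 - Real.exp (-(1 / 2)) with hκ
  have hκ0 : 0 < κ := by
    have : Real.exp (-(1 / 2)) < 1 := by
      rw [← Real.exp_zero]
      exact Real.exp_lt_exp.2 (by norm_num)
    linarith
  have hκ1 : κ ≤ 1 := by linarith [Real.exp_pos (-(1 / 2))]
  have hC := specConst_nonneg X hn lam t hlam
  set Cc := specConst X lam lam t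
  set K := 4 * (1 + Cc) / κ ^ 2 with hK
  have hK4 : 4 ≤ K := by
    rw [hK, le_div_iff₀ (by positivity)]
    nlinarith [pow_le_one₀ (n := 2) hκ0.le hκ1]
  rw [← ENNReal.ofReal_mul (by positivity)]
  refine ENNReal.ofReal_le_ofReal ?_
  have hcross := (gammaCond_iff X β₀ γ lam t hμ).1 hγ
  have hvar : 4 * ∑ j, min 1 (2 * t * μ j) * v j ≤ K * ∑ j, (1 - E j) ^ 2 * v j := by
    have hspec := sum_min_le_specConst_mul X hn hp hlam h1 ht
    have hσ : 0 ≤ σ ^ 2 / n := by positivity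
    have h2 := mul_le_mul_of_nonneg_left hspec hσ
    have h3 : ∑ j, min 1 (2 * t * μ j) * v j ≤
        (1 + Cc) * ∑ j, min 1 (2 * t * μ j) ^ 2 * v j := by
      calc _ = σ ^ 2 / n * ∑ j, min 1 (2 * t * μ j) * (eigVal X j / μ j) := by
            rw [Finset.mul_sum]
            exact Finset.sum_congr rfl fun j _ => by rw [hv]; ring
        _ ≤ _ := h2
        _ = _ := by
            rw [mul_left_comm, Finset.mul_sum]
            congr 1
            exact Finset.sum_congr rfl fun j _ => by rw [hv]; ring
    have h4 : κ ^ 2 * ∑ j, min 1 (2 * t * μ j) ^ 2 * v j ≤ ∑ j, (1 - E j) ^ 2 * v j := by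
      rw [Finset.mul_sum]
      refine Finset.sum_le_sum fun j _ => ?_
      have h5 := one_sub_exp_neg_half_mul_min_le (mul_nonneg htpos.le (hμ j))
      have h6 : 0 ≤ min 1 (2 * (t * μ j)) :=
        le_min zero_le_one (by have := mul_nonneg htpos.le (hμ j); linarith)
      have h7 := pow_le_pow_left₀ (mul_nonneg hκ0.le h6) h5 2
      rw [mul_pow, ← mul_assoc 2 t, ← neg_mul] at h7
      calc _ = κ ^ 2 * min 1 (2 * t * μ j) ^ 2 * v j := by ring
        _ ≤ _ := mul_le_mul_of_nonneg_right h7 (hvnn j)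
    calc _ ≤ 4 * ((1 + Cc) * ∑ j, min 1 (2 * t * μ j) ^ 2 * v j) := by linarith
      _ = K * (κ ^ 2 * ∑ j, min 1 (2 * t * μ j) ^ 2 * v j) := by
          rw [hK]
          field_simp
      _ ≤ _ := mul_le_mul_of_nonneg_left h4 (by linarith)
  have hbias : ∑ j, (2 * (m j - g j) ^ 2 + 4 * (Real.exp (-(2 * t * μ j)) * m j ^ 2)) ≤
      K * ∑ j, ((1 - E j) * m j - g j) ^ 2 := by
    have hE2 : ∀ j, Real.exp (-(2 * t * μ j)) = E j ^ 2 := by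
      intro j
      rw [hE, sq, ← Real.exp_add]
      congr 1
      ring
    have h2 : ∑ j, ((1 - E j) * m j - g j) ^ 2 =
        ∑ j, ((m j - g j) ^ 2 + E j ^ 2 * m j ^ 2) + 2 * ∑ j, E j * m j * (g j - m j) := by
      rw [Finset.mul_sum, ← Finset.sum_add_distrib]
      exact Finset.sum_congr rfl fun j _ => by ring
    have h3 : 0 ≤ ∑ j, ((1 - E j) * m j - g j) ^ 2 := Finset.sum_nonneg fun _ _ => sq_nonneg _
    calc _ ≤ 4 * ∑ j, ((m j - g j) ^ 2 + E j ^ 2 * m j ^ 2) := by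
          rw [Finset.mul_sum]
          refine Finset.sum_le_sum fun j _ => ?_
          rw [hE2]
          nlinarith [sq_nonneg (m j - g j)]
      _ ≤ 4 * ∑ j, ((1 - E j) * m j - g j) ^ 2 := by
          rw [h2]
          have : 0 ≤ ∑ j, E j * m j * (g j - m j) := hcross
          linarith
      _ ≤ _ := mul_le_mul_of_nonneg_right hK4 h3
  rw [Finset.sum_add_distrib (f := fun j => ((1 - E j) * m j - g j) ^ 2), mul_add,
    Finset.sum_add_distrib]
  refine add_le_add hbias (le_trans (le_of_eq ?_) hvar)
  rw [Finset.mul_sum]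
  exact Finset.sum_congr rfl fun j _ => by ring

end RidgeCG

theorem theorem3p7
    {Ω : Type*} [MeasurableSpace Ω] (P : Measure Ω) [IsProbabilityMeasure P]
    {n p : ℕ} (hn : 0 < n) (hp : 0 < p)
    -- feature vectors `x ω i`, `i = 1, …, n`, and responses
    (x : Ω → Fin n → Fin p → ℝ) (hx : Measurable x)
    (y : Ω → Fin n → ℝ) (hy : Measurable y)
    (β₀ : Fin p → ℝ) (σ : ℝ) (hσ : 0 < σ) (lam : ℝ) (hlam : 0 ≤ lam)
    -- the errors `y i - ⟨x i, β₀⟩` are centred and uncorrelated with variance `σ²` given `x`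
    (hmem : ∀ i, MemLp (fun ω => y ω i - x ω i ⬝ᵥ β₀) 2 P)
    (hmean : ∀ i,
      P[fun ω => y ω i - x ω i ⬝ᵥ β₀ | MeasurableSpace.comap x inferInstance] =ᵐ[P] 0)
    (hcov : ∀ i j,
      P[fun ω => (y ω i - x ω i ⬝ᵥ β₀) * (y ω j - x ω j ⬝ᵥ β₀) |
        MeasurableSpace.comap x inferInstance] =ᵐ[P] fun _ => if i = j then σ ^ 2 else 0)
    -- almost all data sets are nondegenerate
    (hnondeg : ∀ᵐ z ∂(P.map fun ω => (x ω, y ω)),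
      RidgeCG.Nondegenerate (Matrix.of z.1) z.2) :
    (∀ (X : Matrix (Fin n) (Fin p) ℝ) (t : ℝ), 0 < RidgeCG.eig X 1 + lam →
      1 / (2 * (RidgeCG.eig X 1 + lam)) ≤ t →
        RidgeCG.specConst X lam lam t ≤ RidgeCG.specConst X lam 0 t) ∧
    (∀ᵐ ω ∂P, 0 < RidgeCG.eig (Matrix.of (x ω)) 1 + lam →
      ∀ (γ : Fin p → ℝ) (t : ℝ),
        1 / (2 * (RidgeCG.eig (Matrix.of (x ω)) 1 + lam)) ≤ t →
        RidgeCG.GammaCond (Matrix.of (x ω)) β₀ lam (2 * t) γ →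
          RidgeCG.risk P x y lam γ (RidgeCG.cgAtTau lam t) ω ≤
            ENNReal.ofReal (4 * (1 + RidgeCG.specConst (Matrix.of (x ω)) lam lam t) /
                (1 - Real.exp (-(1 / 2))) ^ 2) *
              RidgeCG.risk P x y lam γ (RidgeCG.gradFlow lam t) ω) := by

  refine ⟨fun X t h1 ht => RidgeCG.specConst_le_specConst_zero X hn hp hlam h1 ht, ?_⟩
  have hmeas1 : ∀ i, Measurable fun z : (Fin n → Fin p → ℝ) × (Fin n → ℝ) =>
      z.2 i - z.1 i ⬝ᵥ β₀ := by
    intro i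
    simp only [dotProduct]
    fun_prop
  have hxy : Measurable fun ω => (x ω, y ω) := hx.prodMk hy
  have hI1 : ∀ i, Integrable (fun z : (Fin n → Fin p → ℝ) × (Fin n → ℝ) =>
      z.2 i - z.1 i ⬝ᵥ β₀) (P.map fun ω => (x ω, y ω)) := fun i => by
    rw [integrable_map_measure (hmeas1 i).aestronglyMeasurable hxy.aemeasurable]
    exact (hmem i).integrable one_le_two
  have hI2 : ∀ i j, Integrable (fun z : (Fin n → Fin p → ℝ) × (Fin n → ℝ) =>
      (z.2 i - z.1 i ⬝ᵥ β₀) * (z.2 j - z.1 j ⬝ᵥ β₀)) (P.map fun ω => (x ω, y ω)) := fun i j => by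
    refine (integrable_map_measure ((hmeas1 i).mul (hmeas1 j)).aestronglyMeasurable
      hxy.aemeasurable).2 ?_
    exact (hmem i).integrable_mul (hmem j)
  have hnd : ∀ᵐ ω ∂P, ∀ᵐ z ∂condDistrib y x P (x ω),
      RidgeCG.Nondegenerate (Matrix.of (x ω)) z := by
    rw [← compProd_map_condDistrib hy.aemeasurable] at hnondeg
    exact ae_of_ae_map hx.aemeasurable (Measure.ae_ae_of_ae_compProd hnondeg)
  have hc1 : ∀ᵐ ω ∂P, ∀ i, Integrable (fun z : Fin n → ℝ => z i - x ω i ⬝ᵥ β₀)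
      (condDistrib y x P (x ω)) :=
    ae_all_iff.2 fun i => (hI1 i).condDistrib_ae hx.aemeasurable hy.aemeasurable
  have hc2 : ∀ᵐ ω ∂P, ∀ i j, Integrable (fun z : Fin n → ℝ =>
      (z i - x ω i ⬝ᵥ β₀) * (z j - x ω j ⬝ᵥ β₀)) (condDistrib y x P (x ω)) :=
    ae_all_iff.2 fun i => ae_all_iff.2 fun j =>
      (hI2 i j).condDistrib_ae hx.aemeasurable hy.aemeasurable
  have hm1 : ∀ᵐ ω ∂P, ∀ i, ∫ z, (z i - x ω i ⬝ᵥ β₀) ∂condDistrib y x P (x ω) = 0 := by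
    refine ae_all_iff.2 fun i => ?_
    filter_upwards [condExp_prod_ae_eq_integral_condDistrib' hx hy.aemeasurable (hI1 i),
      hmean i] with ω h1 h2
    exact h1.symm.trans h2
  have hm2 : ∀ᵐ ω ∂P, ∀ i j, ∫ z, (z i - x ω i ⬝ᵥ β₀) * (z j - x ω j ⬝ᵥ β₀)
      ∂condDistrib y x P (x ω) = if i = j then σ ^ 2 else 0 := by
    refine ae_all_iff.2 fun i => ae_all_iff.2 fun j => ?_
    filter_upwards [condExp_prod_ae_eq_integral_condDistrib' hx hy.aemeasurable (hI2 i j),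
      hcov i j] with ω h1 h2
    exact h1.symm.trans h2
  filter_upwards [hnd, hc1, hc2, hm1, hm2] with ω hnd hc1 hc2 hm1 hm2 h1 γ t ht hγ
  exact RidgeCG.lintegral_loss_cg_le hn hp (Matrix.of (x ω)) β₀ γ hlam h1 ht hγ
    (condDistrib y x P (x ω)) hc1 hc2 hm1 hm2 hnd
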